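/- Let $\alpha,q,s>0$ and let $C_{A1},C_{A2},C_{B1},C_{B2},C_{B3}$ be real numbers. There exists a constant $C>0$, depending only on these eight numbers, such that the following holds. Let $\mathcal G=(\mathcal V,\mathcal E)$ be a simple graph with finite or countable vertex set in which every vertex has degree at most $\kappa$, and let $k\ge 1$ be an integer with $s\le \frac{\alpha q}{2k\alpha+kq}$. Let $v(x)$, $x\in\mathcal V$, be independent identically distributed real random variables on a probability space $(\Omega,\mathbb P)$ whose distribution $\mu$ satisfies $\mu[t-\epsilon,t+\epsilon]\le C_{A1}\epsilon^{\alpha}$ for all $t\in\mathbb R$, $\epsilon>0$, and $\int|t|^q\,d\mu(t)\le C_{A2}$. Let $A(x),B(x)$ be Hermitian $k\times k$ matrices with $A(x)$ invertible, $\|A(x)\|,\|A(x)^{-1}\|\le C_{B1}$ and $\|B(x)\|\le C_{B2}$, and for adjacent $x,y$ let $K(x,y)$ be a $k\times k$ matrix with $K(y,x)=K(x,y)^*$ and $\|K(x,y)\|\le C_{B3}$ (operator norms). Set $V(x)=v(x)A(x)+B(x)$, let $g>0$, and let $H$ be the random operator on $\ell^2(\mathcal V)\otimes\mathbb C^k$,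 $$(H\psi)(x)=V(x)\psi(x)+g^{-1}\sum_{y\sim x}K(x,y)\psi(y),$$ on its maximal domain $\{\psi : H\psi\in\ell^2(\mathcal V)\otimes\mathbb C^k\}$. Then the resolvent $G_z=(H-z)^{-1}$ exists for every $z\in\mathbb C\setminus\mathbb R$; denote its $k\times k$ matrix elements by $G_z(x,y)$. Moreover, for every $\lambda\in\mathbb R$ with $g\ge C\kappa^{1/s}/(1+|\lambda|)$ and all $x,y\in\mathcal V$: the limit $G_{\lambda+i0}(x,y)=\lim_{\epsilon\to+0}G_{\lambda+i\epsilon}(x,y)$ exists almost surely, $$\lim_{\epsilon\to+0}\mathbb E\|G_{\lambda+i\epsilon}(x,y)\|^s=\mathbb E\|G_{\lambda+i0}(x,y)\|^s,$$ and $$\mathbb E\|G_{\lambda+i0}(x,y)\|^s\le\frac{C}{(1+|\lambda|)^s}\left(\frac{C\kappa}{g^s(1+|\lambda|)^s}\right)^{\mathrm{dist}(x,y)},$$ where $\mathrm{dist}$ is the graph distance and the right-hand side is read as $0$ if $x$ and $y$ are not connected by a path. -/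

import Mathlib

open MeasureTheory ProbabilityTheory Filter Topology
open scoped Matrix Matrix.Norms.L2Operator ENNReal

universe u w

noncomputable section

/-- `k × k` complex matrices; `‖·‖` on them is the operator norm of `ℂᵏ` with its Euclidean norm. -/
abbrev Mat (k : ℕ) : Type := Matrix (Fin k) (Fin k) ℂ

/-- The fibre `ℂᵏ` with the Euclidean norm. -/
abbrev Fib (k : ℕ) : Type := EuclideanSpace ℂ (Fin k)

/-- The Hilbert space `ℓ²(V) ⊗ ℂᵏ` of square-summable functions `ψ : V → ℂᵏ`. -/
abbrev L2 (V : Type u) (k : ℕ) : Type u := lp (fun _ : V => Fib k) 2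

/-- `μ` is `α`-regular with constant `C`. -/
def IsAlphaRegular (μ : Measure ℝ) (α C : ℝ) : Prop :=
  ∀ t ε : ℝ, 0 < ε → μ (Set.Icc (t - ε) (t + ε)) ≤ ENNReal.ofReal (C * ε ^ α)

/-- `μ` has a finite absolute `q`-moment, bounded by `C`. -/
def HasMomentBound (μ : Measure ℝ) (q C : ℝ) : Prop :=
  ∫⁻ t, ENNReal.ofReal (|t| ^ q) ∂μ ≤ ENNReal.ofReal C

/-- The matrix potential `V(x) = v(x) A(x) + B(x)`. -/
def sitePotential {V : Type u} {k : ℕ} (A B : V → Mat k) (v : V → ℝ) (x : V) : Mat k :=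
  ((v x : ℝ) : ℂ) • A x + B x

/-- The expression `(Hψ)(x) = W(x) ψ(x) + g⁻¹ ∑_{y ∼ x} K(x,y) ψ(y)` for arbitrary `ψ : V → ℂᵏ`. -/
def formalHam {V : Type u} {k : ℕ} (G : SimpleGraph V) [G.LocallyFinite]
    (K : V → V → Mat k) (g : ℝ) (W : V → Mat k) : (V → Fib k) →ₗ[ℂ] (V → Fib k) where
  toFun ψ x := Matrix.toEuclideanLin (W x) (ψ x)
    + ((g⁻¹ : ℝ) : ℂ) • ∑ y ∈ G.neighborFinset x, Matrix.toEuclideanLin (K x y) (ψ y)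
  map_add' ψ φ := by
    funext x
    simp only [Pi.add_apply, map_add, Finset.sum_add_distrib, smul_add]
    abel
  map_smul' c ψ := by
    funext x
    simp only [Pi.smul_apply, map_smul, RingHom.id_apply, smul_add, ← Finset.smul_sum]
    rw [smul_comm]

/-- The Hamiltonian as an (in general unbounded) operator on `ℓ²(V) ⊗ ℂᵏ`, on its maximal domain
`{ψ ∈ ℓ² | Hψ ∈ ℓ²}`. -/
def hamiltonian {V : Type u} {k : ℕ} (G : SimpleGraph V) [G.LocallyFinite]
    (K : V → V → Mat k) (g : ℝ) (W : V → Mat k) : L2 V k →ₗ.[ℂ] L2 V k where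
  domain :=
    { carrier := {ψ | Memℓp (formalHam G K g W (ψ : V → Fib k)) 2}
      zero_mem' := by
        simp only [Set.mem_ofPred_eq, lp.coeFn_zero, map_zero]
        exact zero_memℓp
      add_mem' := by
        intro ψ φ hψ hφ
        simp only [Set.mem_ofPred_eq, lp.coeFn_add, map_add] at hψ hφ ⊢
        exact hψ.add hφ
      smul_mem' := by
        intro c ψ hψ
        simp only [Set.mem_ofPred_eq, lp.coeFn_smul, map_smul] at hψ ⊢
        exact hψ.const_smul c }
  toFun :=
    { toFun := fun ψ => ⟨formalHam G K g W (ψ.1 : V → Fib k), ψ.2⟩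
      map_add' := by
        intro ψ φ
        apply Subtype.ext
        simp only [Submodule.coe_add, lp.coeFn_add, map_add]
        rfl
      map_smul' := by
        intro c ψ
        apply Subtype.ext
        simp only [Submodule.coe_smul, lp.coeFn_smul, map_smul]
        rfl }

/-- `R` is the resolvent `(T - z)⁻¹`: a bounded, everywhere defined, two-sided inverse of
`T - z : dom T → E`. -/
def IsResolventAt {E : Type*} [NormedAddCommGroup E] [NormedSpace ℂ E]
    (T : E →ₗ.[ℂ] E) (z : ℂ) (R : E →L[ℂ] E) : Prop :=
  (∀ φ : E, ∃ h : R φ ∈ T.domain, T ⟨R φ, h⟩ - z • R φ = φ) ∧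
  (∀ ψ : T.domain, R (T ψ - z • (ψ : E)) = ψ)

open Classical in
/-- The resolvent `(T - z)⁻¹`, and `0` when `z` is in the spectrum of `T`. -/
def resolventOp {E : Type*} [NormedAddCommGroup E] [NormedSpace ℂ E]
    (T : E →ₗ.[ℂ] E) (z : ℂ) : E →L[ℂ] E :=
  if h : ∃ R, IsResolventAt T z R then h.choose else 0

open Classical in
/-- The matrix element `T(x,y)`, a `k × k` matrix: `T(x,y) u = (T (δ_y ⊗ u))(x)`. -/
def kernelAt {V : Type u} {k : ℕ} (T : L2 V k →L[ℂ] L2 V k) (x y : V) : Mat k :=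
  Matrix.of fun i j => (T (lp.single 2 y (EuclideanSpace.single j (1 : ℂ)))) x i

/-- The Green function `G_z(x,y)` of the Hamiltonian. -/
def green {V : Type u} {k : ℕ} (G : SimpleGraph V) [G.LocallyFinite]
    (K : V → V → Mat k) (g : ℝ) (W : V → Mat k) (z : ℂ) (x y : V) : Mat k :=
  kernelAt (resolventOp (hamiltonian G K g W) z) x y

/-- The boundary value `G_{λ+i0}(x,y) = lim_{ε → +0} G_{λ+iε}(x,y)`. -/
def greenBoundary {V : Type u} {k : ℕ} (G : SimpleGraph V) [G.LocallyFinite]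
    (K : V → V → Mat k) (g : ℝ) (W : V → Mat k) (lam : ℝ) (x y : V) : Mat k :=
  limUnder (𝓝[>] (0 : ℝ)) fun ε : ℝ => green G K g W ((lam : ℂ) + (ε : ℂ) * Complex.I) x y

/-- The fractional moment `⟨‖M‖^s⟩` of a random matrix. -/
def fracMoment {Ω : Type w} [MeasurableSpace Ω] (P : Measure Ω) {k : ℕ} (s : ℝ)
    (M : Ω → Mat k) : ℝ≥0∞ :=
  ∫⁻ ω, ENNReal.ofReal (‖M ω‖ ^ s) ∂P

open Classical in
/-- `r ^ dist(x,y)`, with value `0` when `dist(x,y) = ∞`. -/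
def powDist {V : Type u} (G : SimpleGraph V) (r : ℝ) (x y : V) : ℝ :=
  if G.Reachable x y then r ^ G.dist x y else 0

end

/- Freeze the potential at every site but `x` and let `t = v(x)` vary. The resolvent identity for
this rank-`k` perturbation shows that `X(t) = G_z(x, y)` solves a linear pencil equation
`(1 + t N) X(t) = F`, so by Cramer's rule its entries are rational functions of `t` of bounded
degree. For such functions the fractional moment over `t` is dominated by the part off any set of
sufficiently small measure: a rational function is comparable to a constant, up to factors
measuring the distance of `t` to its roots and poles, and `α`-regularity together with the moment
bound makes these factors integrable to the power `s`. Off a suitable small set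
`V(x) - z = t A + B - z` is invertible with inverse of order `1 / (1 + |λ|)`, hence
`E‖G_z(x, y)‖^s ≤ c (1 + |λ|)^(-s) E‖(V(x) - z) G_z(x, y)‖^s`. Substituting the Green function
equation for `(V(x) - z) G_z(x, y)` makes `x ↦ E‖G_z(x, y)‖^s` a subsolution of
`m = a δ_y + ρ ∑_{u ∼ ·} m u` with `κ ρ ≤ 1/2`, and iterating this inequality along the graph gives
`(κ ρ)^dist(x, y)` decay and summability over `x`, uniformly in `0 < ε ≤ 1`.

For the boundary values, `‖(H - λ - iε)⁻¹ φ‖` increases as `ε ↓ 0`, and if it stays bounded the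
vectors themselves converge. As `s ≤ 2`, summability over `x` bounds the `s`-th moments of the norms
`‖(H - λ - iε)⁻¹ (δ_y ⊗ e_j)‖`; their monotone limits are thus almost surely finite, and dominate
the convergence of the fractional moments. -/

section SelfAdjointOperators

variable {E : Type*} [NormedAddCommGroup E] [InnerProductSpace ℂ E]
  {T : E →ₗ.[ℂ] E} {z z' : ℂ} {ψ φ ψ' φ' : E}

/-- `ψ` is a solution in the domain of `T` of the resolvent equation `(T - z) ψ = φ`, expressed
through the graph of `T`. -/
def Solves (T : E →ₗ.[ℂ] E) (z : ℂ) (ψ φ : E) : Prop :=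
  (ψ, φ + z • ψ) ∈ T.graph

namespace Solves

lemma mem_domain (h : Solves T z ψ φ) : ψ ∈ T.domain :=
  T.mem_domain_of_mem_graph h

lemma apply_eq (h : Solves T z ψ φ) : T ⟨ψ, h.mem_domain⟩ = φ + z • ψ :=
  T.mem_graph_snd_inj (T.mem_graph ⟨ψ, h.mem_domain⟩) h rfl

lemma of_mem_domain (ψ : T.domain) : Solves T z ψ (T ψ - z • (ψ : E)) := by
  rw [Solves, sub_add_cancel]
  exact T.mem_graph ψ

protected lemma add (h : Solves T z ψ φ) (h' : Solves T z ψ' φ') :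
    Solves T z (ψ + ψ') (φ + φ') := by
  rw [Solves, smul_add, add_add_add_comm]
  exact T.graph.add_mem h h'

protected lemma sub (h : Solves T z ψ φ) (h' : Solves T z ψ' φ') :
    Solves T z (ψ - ψ') (φ - φ') := by
  rw [Solves, smul_sub, sub_add_sub_comm]
  exact T.graph.sub_mem h h'

protected lemma smul (h : Solves T z ψ φ) (a : ℂ) : Solves T z (a • ψ) (a • φ) := by
  rw [Solves, smul_comm, ← smul_add]
  exact T.graph.smul_mem a h

lemma shift (h : Solves T z ψ φ) (z' : ℂ) : Solves T z' ψ (φ + (z - z') • ψ) := by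
  rwa [Solves, sub_smul, add_assoc, sub_add_cancel]

lemma eq_of_isResolventAt {R : E →L[ℂ] E} (hR : IsResolventAt T z R) (h : Solves T z ψ φ) :
    R φ = ψ := by
  have := hR.2 ⟨ψ, h.mem_domain⟩
  rwa [h.apply_eq, add_sub_cancel_right] at this

end Solves

lemma IsResolventAt.solves {R : E →L[ℂ] E} (hR : IsResolventAt T z R) (φ : E) :
    Solves T z (R φ) φ := by
  obtain ⟨hdom, hφ⟩ := hR.1 φ
  rw [Solves, ← eq_add_of_sub_eq hφ]
  exact T.mem_graph ⟨R φ, hdom⟩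

lemma isClosed_setOf_solves (hT : T.IsClosed) (z : ℂ) :
    IsClosed {p : E × E | Solves T z p.1 p.2} :=
  hT.preimage (f := fun p : E × E => (p.1, p.2 + z • p.1)) (by fun_prop)

variable [CompleteSpace E]

lemma inner_eq_inner_of_mem_graph (hT : IsSelfAdjoint T) (h : (ψ, φ) ∈ T.graph)
    (h' : (ψ', φ') ∈ T.graph) : inner ℂ φ ψ' = inner ℂ ψ φ' := by
  rw [LinearPMap.mem_graph_iff] at h h'
  obtain ⟨⟨x, rfl, rfl⟩, y, rfl, rfl⟩ := h, h'
  have hadj := T.adjoint_isFormalAdjoint hT.dense_domain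
  rw [LinearPMap.isSelfAdjoint_def.1 hT] at hadj
  exact hadj x y

lemma mem_graph_of_forall_inner_eq (hT : IsSelfAdjoint T)
    (h : ∀ x : T.domain, inner ℂ φ (x : E) = inner ℂ ψ (T x)) : (ψ, φ) ∈ T.graph := by
  have hψ : ψ ∈ (LinearPMap.adjoint T).domain := T.mem_adjoint_domain_of_exists ψ ⟨φ, h⟩
  have hφ := T.adjoint_apply_eq hT.dense_domain ⟨ψ, hψ⟩ h
  rw [← LinearPMap.isSelfAdjoint_def.1 hT, ← hφ]
  exact LinearPMap.mem_graph _ (⟨ψ, hψ⟩ : (LinearPMap.adjoint T).domain)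

namespace Solves

lemma im_inner_eq (hT : IsSelfAdjoint T) (h : Solves T z ψ φ) :
    (inner ℂ ψ φ).im = -z.im * ‖ψ‖ ^ 2 := by
  have hreal : (inner ℂ ψ (φ + z • ψ)).im = 0 := by
    rw [← Complex.conj_eq_iff_im, inner_conj_symm]
    exact inner_eq_inner_of_mem_graph hT h h
  have hself : (inner ℂ ψ ψ : ℂ) = ((‖ψ‖ ^ 2 : ℝ) : ℂ) := by
    rw [inner_self_eq_norm_sq_to_K]
    norm_cast
  rw [inner_add_right, inner_smul_right, hself, Complex.add_im, Complex.im_mul_ofReal] at hreal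
  linarith

lemma abs_im_mul_norm_le (hT : IsSelfAdjoint T) (h : Solves T z ψ φ) :
    |z.im| * ‖ψ‖ ≤ ‖φ‖ := by
  have hsq : |z.im| * ‖ψ‖ ^ 2 ≤ ‖ψ‖ * ‖φ‖ := by
    calc |z.im| * ‖ψ‖ ^ 2 = |(inner ℂ ψ φ : ℂ).im| := by
          rw [h.im_inner_eq hT, abs_mul, abs_neg, abs_of_nonneg (sq_nonneg ‖ψ‖)]
      _ ≤ ‖(inner ℂ ψ φ : ℂ)‖ := Complex.abs_im_le_norm _
      _ ≤ ‖ψ‖ * ‖φ‖ := norm_inner_le_norm _ _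
  rcases (norm_nonneg ψ).eq_or_lt with h0 | h0
  · rw [← h0, mul_zero]
    exact norm_nonneg φ
  · nlinarith

lemma norm_le (hT : IsSelfAdjoint T) (hz : z.im ≠ 0) (h : Solves T z ψ φ) :
    ‖ψ‖ ≤ |z.im|⁻¹ * ‖φ‖ := by
  rw [inv_mul_eq_div, le_div_iff₀' (abs_pos.2 hz)]
  exact h.abs_im_mul_norm_le hT

lemma eq_zero (hT : IsSelfAdjoint T) (hz : z.im ≠ 0) (h : Solves T z ψ 0) : ψ = 0 := by
  simpa only [norm_zero, mul_zero, norm_le_zero_iff] using h.norm_le hT hz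

lemma unique (hT : IsSelfAdjoint T) (hz : z.im ≠ 0) (h : Solves T z ψ φ)
    (h' : Solves T z ψ' φ) : ψ = ψ' :=
  sub_eq_zero.1 (eq_zero hT hz (sub_self φ ▸ h.sub h'))

end Solves

/-- The range of `T - z`. -/
def solvesRange (T : E →ₗ.[ℂ] E) (z : ℂ) : Submodule ℂ E where
  carrier := {φ | ∃ ψ, Solves T z ψ φ}
  zero_mem' := ⟨0, by
    rw [Solves, smul_zero, add_zero]
    exact T.graph.zero_mem⟩
  add_mem' := by
    rintro φ φ' ⟨ψ, h⟩ ⟨ψ', h'⟩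
    exact ⟨_, h.add h'⟩
  smul_mem' := by
    rintro a φ ⟨ψ, h⟩
    exact ⟨_, h.smul a⟩

lemma isClosed_solvesRange (hT : IsSelfAdjoint T) (hz : z.im ≠ 0) :
    IsClosed (solvesRange T z : Set E) := by
  refine IsSeqClosed.isClosed fun φ φ₀ hφ hlim => ?_
  choose ψ hψ using hφ
  have hcauchy : CauchySeq ψ := by
    have hφ := Metric.cauchySeq_iff.1 hlim.cauchySeq
    refine Metric.cauchySeq_iff.2 fun ε hε => ?_
    obtain ⟨N, hN⟩ := hφ (|z.im| * ε) (mul_pos (abs_pos.2 hz) hε)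
    refine ⟨N, fun m hm n hn => ?_⟩
    have hmn := hN m hm n hn
    rw [dist_eq_norm] at hmn ⊢
    exact lt_of_mul_lt_mul_left
      ((((hψ m).sub (hψ n)).abs_im_mul_norm_le hT).trans_lt hmn) (abs_nonneg _)
  obtain ⟨ψ₀, hψ₀⟩ := cauchySeq_tendsto_of_complete hcauchy
  exact ⟨ψ₀, (isClosed_setOf_solves hT.isClosed z).mem_of_tendsto (hψ₀.prodMk_nhds hlim)
    (Eventually.of_forall hψ)⟩

lemma orthogonal_solvesRange (hT : IsSelfAdjoint T) (hz : z.im ≠ 0) :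
    (solvesRange T z)ᗮ = ⊥ := by
  refine (Submodule.eq_bot_iff _).2 fun η hη => ?_
  have hker : Solves T (starRingEnd ℂ z) η 0 := by
    refine mem_graph_of_forall_inner_eq hT fun x => ?_
    have hx := Submodule.inner_left_of_mem_orthogonal (K := solvesRange T z)
      ⟨x, Solves.of_mem_domain x⟩ hη
    rw [inner_sub_right, inner_smul_right, sub_eq_zero] at hx
    rw [zero_add, inner_smul_left, Complex.conj_conj, hx]
  exact hker.eq_zero hT (by simpa using hz)

theorem exists_solves (hT : IsSelfAdjoint T) (hz : z.im ≠ 0) (φ : E) : ∃ ψ, Solves T z ψ φ := by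
  have htop := Submodule.topologicalClosure_eq_top_iff.2 (orthogonal_solvesRange hT hz)
  rw [(isClosed_solvesRange hT hz).submodule_topologicalClosure_eq] at htop
  exact htop.ge (Submodule.mem_top (x := φ))

theorem exists_isResolventAt (hT : IsSelfAdjoint T) (hz : z.im ≠ 0) :
    ∃ R, IsResolventAt T z R := by
  choose R hR using exists_solves hT hz
  let L : E →ₗ[ℂ] E :=
    { toFun := R
      map_add' := fun φ φ' => (hR _).unique hT hz ((hR φ).add (hR φ'))
      map_smul' := fun a φ => (hR _).unique hT hz ((hR φ).smul a) }
  refine ⟨L.mkContinuous |z.im|⁻¹ fun φ => (hR φ).norm_le hT hz,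
    fun φ => ⟨(hR φ).mem_domain, sub_eq_of_eq_add (hR φ).apply_eq⟩,
    fun ψ => (hR _).unique hT hz (Solves.of_mem_domain ψ)⟩

lemma isResolventAt_resolventOp (hT : IsSelfAdjoint T) (hz : z.im ≠ 0) :
    IsResolventAt T z (resolventOp T z) := by
  rw [resolventOp, dif_pos (exists_isResolventAt hT hz)]
  exact (exists_isResolventAt hT hz).choose_spec

lemma solves_resolventOp (hT : IsSelfAdjoint T) (hz : z.im ≠ 0) (φ : E) :
    Solves T z (resolventOp T z φ) φ :=
  (isResolventAt_resolventOp hT hz).solves φ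

lemma Solves.resolventOp_eq (hT : IsSelfAdjoint T) (hz : z.im ≠ 0) (h : Solves T z ψ φ) :
    resolventOp T z φ = ψ :=
  h.eq_of_isResolventAt (isResolventAt_resolventOp hT hz)

lemma norm_resolventOp_le (hT : IsSelfAdjoint T) (hz : z.im ≠ 0) :
    ‖resolventOp T z‖ ≤ |z.im|⁻¹ :=
  ContinuousLinearMap.opNorm_le_bound _ (by positivity) fun φ =>
    (solves_resolventOp hT hz φ).norm_le hT hz

end SelfAdjointOperators

section ResolventLimits

theorem tendsto_clm_apply_of_dense_span {𝕜 E F ι : Type*} [NontriviallyNormedField 𝕜]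
    [NormedAddCommGroup E] [NormedSpace 𝕜 E] [NormedAddCommGroup F] [NormedSpace 𝕜 F]
    {l : Filter ι} {C : ℝ} {R : ι → E →L[𝕜] F} {R₀ : E →L[𝕜] F} (hR : ∀ i, ‖R i‖ ≤ C)
    {s : Set E} (hs : Dense (Submodule.span 𝕜 s : Set E))
    (hlim : ∀ φ ∈ s, Tendsto (fun i => R i φ) l (𝓝 (R₀ φ))) (φ : E) :
    Tendsto (fun i => R i φ) l (𝓝 (R₀ φ)) := by
  let S : Submodule 𝕜 E :=
    { carrier := {φ | Tendsto (fun i => R i φ) l (𝓝 (R₀ φ))}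
      zero_mem' := by simpa only [Set.mem_ofPred_eq, map_zero] using tendsto_const_nhds
      add_mem' := fun {a b} ha hb => by
        simp only [Set.mem_ofPred_eq, map_add] at ha hb ⊢
        exact ha.add hb
      smul_mem' := fun a b hb => by
        simp only [Set.mem_ofPred_eq, map_smul] at hb ⊢
        exact hb.const_smul a }
  have hclosed : IsClosed (S : Set E) :=
    (LipschitzWith.uniformEquicontinuous (fun i => (R i : E → F)) C.toNNReal fun i =>
      (R i).lipschitz.weaken (NNReal.le_toNNReal_of_coe_le (hR i))).equicontinuous
        |>.isClosed_setOfPred_tendsto R₀.continuous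
  exact closure_minimal (Submodule.span_le (p := S) |>.2 hlim) hclosed (hs φ)

variable {E : Type*} [NormedAddCommGroup E] [InnerProductSpace ℂ E] [CompleteSpace E]
  {T : E →ₗ.[ℂ] E} {z : ℂ}

-- By the second resolvent identity, `(Tᵢ - z)⁻¹ φ₀ - ψ = (Tᵢ - z)⁻¹ (φ₀ - φᵢ)`
-- whenever `(Tᵢ - z) ψ = φᵢ`.
lemma tendsto_resolventOp_of_solves {ι : Type*} {l : Filter ι} {T : ι → E →ₗ.[ℂ] E}
    (hT : ∀ i, IsSelfAdjoint (T i)) (hz : z.im ≠ 0) {ψ φ₀ : E} {φ : ι → E}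
    (hφ : ∀ i, Solves (T i) z ψ (φ i)) (hlim : Tendsto φ l (𝓝 φ₀)) :
    Tendsto (fun i => resolventOp (T i) z φ₀) l (𝓝 ψ) := by
  rw [tendsto_iff_norm_sub_tendsto_zero]
  have hbound : Tendsto (fun i => |z.im|⁻¹ * ‖φ₀ - φ i‖) l (𝓝 0) := by
    simpa only [sub_self, norm_zero, mul_zero] using
      ((tendsto_const_nhds (x := φ₀)).sub hlim).norm.const_mul |z.im|⁻¹
  refine squeeze_zero (fun _ => norm_nonneg _) (fun i => ?_) hbound
  have hψ : resolventOp (T i) z (φ i) = ψ := (hφ i).resolventOp_eq (hT i) hz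
  nth_rw 1 [← hψ]
  rw [← map_sub]
  exact ContinuousLinearMap.le_of_opNorm_le _ (norm_resolventOp_le (hT i) hz) _

-- Comparing the imaginary parts of `⟪ψ' - ψ, (T - λ - iε') (ψ' - ψ)⟫` gives
-- `Re ⟪ψ' - ψ, ψ⟫ ≥ 0`.
lemma norm_sub_sq_le_of_solves (hT : IsSelfAdjoint T) {lam ε ε' : ℝ} (hε' : 0 < ε') (hε : ε' ≤ ε)
    {φ ψ ψ' : E} (h : Solves T (lam + ε * Complex.I) ψ φ)
    (h' : Solves T (lam + ε' * Complex.I) ψ' φ) :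
    ‖ψ' - ψ‖ ^ 2 ≤ ‖ψ'‖ ^ 2 - ‖ψ‖ ^ 2 := by
  rcases hε.eq_or_lt with rfl | hlt
  · simp [h'.unique hT (by simpa using hε'.ne') h]
  have him := (h'.sub (h.shift (lam + ε' * Complex.I))).im_inner_eq hT
  have hrhs : φ - (φ + ((lam + ε * Complex.I : ℂ) - (lam + ε' * Complex.I)) • ψ) =
      (((ε' - ε : ℝ) : ℂ) * Complex.I) • ψ := by
    rw [sub_add_cancel_left, ← neg_smul]
    congr 1
    push_cast
    ring
  have hre : (ε' - ε) * (inner ℂ (ψ' - ψ) ψ : ℂ).re = -ε' * ‖ψ' - ψ‖ ^ 2 := by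
    rw [hrhs, inner_smul_right, mul_assoc, Complex.im_ofReal_mul, Complex.I_mul_im] at him
    simpa only [Complex.add_im, Complex.ofReal_im, Complex.re_ofReal_mul, Complex.im_ofReal_mul,
      Complex.I_im, mul_one, zero_add] using him
  have hnonneg : 0 ≤ (inner ℂ (ψ' - ψ) ψ : ℂ).re := by
    nlinarith [mul_nonneg hε'.le (sq_nonneg ‖ψ' - ψ‖)]
  have hexpand := norm_add_sq (𝕜 := ℂ) (ψ' - ψ) ψ
  rw [sub_add_cancel, RCLike.re_eq_complex_re] at hexpand
  linarith

/-- The vector `(T - λ - iε)⁻¹ φ`, as a function of `ε`. -/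
noncomputable def boundaryFamily (T : E →ₗ.[ℂ] E) (lam : ℝ) (φ : E) (ε : ℝ) : E :=
  resolventOp T (lam + ε * Complex.I) φ

lemma solves_boundaryFamily (hT : IsSelfAdjoint T) (lam : ℝ) (φ : E) {ε : ℝ} (hε : 0 < ε) :
    Solves T (lam + ε * Complex.I) (boundaryFamily T lam φ ε) φ :=
  solves_resolventOp hT (by simpa using hε.ne') φ

lemma norm_boundaryFamily_sub_sq_le (hT : IsSelfAdjoint T) (lam : ℝ) (φ : E) {ε ε' : ℝ}
    (hε' : 0 < ε') (h : ε' ≤ ε) :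
    ‖boundaryFamily T lam φ ε' - boundaryFamily T lam φ ε‖ ^ 2 ≤
      ‖boundaryFamily T lam φ ε'‖ ^ 2 - ‖boundaryFamily T lam φ ε‖ ^ 2 :=
  norm_sub_sq_le_of_solves hT hε' h (solves_boundaryFamily hT lam φ (hε'.trans_le h))
    (solves_boundaryFamily hT lam φ hε')

lemma norm_boundaryFamily_anti (hT : IsSelfAdjoint T) (lam : ℝ) (φ : E) {ε ε' : ℝ}
    (hε' : 0 < ε') (h : ε' ≤ ε) :
    ‖boundaryFamily T lam φ ε‖ ≤ ‖boundaryFamily T lam φ ε'‖ := by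
  refine le_of_sq_le_sq (sub_nonneg.1 ?_) (norm_nonneg _)
  exact (sq_nonneg _).trans (norm_boundaryFamily_sub_sq_le hT lam φ hε' h)

theorem exists_tendsto_boundaryFamily (hT : IsSelfAdjoint T) (lam : ℝ) (φ : E) {M : ℝ}
    (hM : ∀ ε, 0 < ε → ‖boundaryFamily T lam φ ε‖ ≤ M) :
    ∃ ψ, Tendsto (boundaryFamily T lam φ) (𝓝[>] 0) (𝓝 ψ) := by
  set ψ := boundaryFamily T lam φ
  set F : Set ℝ := (fun ε => ‖ψ ε‖ ^ 2) '' Set.Ioi 0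
  have hbdd : BddAbove F := by
    refine ⟨M ^ 2, ?_⟩
    rintro _ ⟨ε, hε, rfl⟩
    exact pow_le_pow_left₀ (norm_nonneg _) (hM ε hε) 2
  refine CompleteSpace.complete (f := map ψ (𝓝[>] 0)) (Metric.cauchy_iff.2 ⟨inferInstance, ?_⟩)
  intro δ hδ
  obtain ⟨_, ⟨ε₀, hε₀, rfl⟩, hsup⟩ := exists_lt_of_lt_csSup (Set.nonempty_Ioi.image _)
    (show sSup F - (δ / 2) ^ 2 < sSup F from sub_lt_self _ (by positivity))
  have hclose : ∀ ε ∈ Set.Ioc 0 ε₀, dist (ψ ε) (ψ ε₀) < δ / 2 := by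
    intro ε hε
    have hle : ‖ψ ε‖ ^ 2 ≤ sSup F := le_csSup hbdd ⟨ε, hε.1, rfl⟩
    rw [dist_eq_norm]
    refine lt_of_pow_lt_pow_left₀ 2 (by positivity)
      ((norm_boundaryFamily_sub_sq_le hT lam φ hε.1 hε.2).trans_lt ?_)
    simp only at hsup
    linarith
  refine ⟨ψ '' Set.Ioc 0 ε₀, image_mem_map (Ioc_mem_nhdsGT hε₀), ?_⟩
  rintro _ ⟨a, ha, rfl⟩ _ ⟨b, hb, rfl⟩
  linarith [dist_triangle_right (ψ a) (ψ b) (ψ ε₀), hclose a ha, hclose b hb]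

end ResolventLimits

section Neighbors

variable {V : Type u} {G : SimpleGraph V} [G.LocallyFinite]

open Classical in
lemma hasSum_ite_adj {M : Type*} [AddCommMonoid M] [TopologicalSpace M] (f : V → M) (x : V) :
    HasSum (fun y => if G.Adj x y then f y else 0) (∑ y ∈ G.neighborFinset x, f y) := by
  simp only [← SimpleGraph.mem_neighborFinset]
  rw [← Finset.sum_congr rfl fun y hy => if_pos hy]
  exact hasSum_sum_of_ne_finset_zero fun y hy => if_neg hy

open Classical in
lemma summable_ite_adj_fst {κ : ℕ} (hdeg : ∀ x, G.degree x ≤ κ) {a : V → ℝ} (ha : ∀ x, 0 ≤ a x)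
    (hsum : Summable a) : Summable fun p : V × V => if G.Adj p.1 p.2 then a p.1 else 0 := by
  have hnonneg : ∀ p : V × V, 0 ≤ if G.Adj p.1 p.2 then a p.1 else 0 := fun p => by
    split_ifs
    exacts [ha p.1, le_rfl]
  have hfiber : ∀ x, HasSum (fun y => if G.Adj x y then a x else 0) (G.degree x * a x) := by
    intro x
    simpa only [Finset.sum_const, nsmul_eq_mul, SimpleGraph.card_neighborFinset_eq_degree]
      using hasSum_ite_adj (G := G) (fun _ => a x) x
  refine (summable_prod_of_nonneg hnonneg).2 ⟨fun x => (hfiber x).summable, ?_⟩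
  simp only [(hfiber _).tsum_eq]
  refine Summable.of_nonneg_of_le (fun x => mul_nonneg (Nat.cast_nonneg _) (ha x)) (fun x => ?_)
    (hsum.mul_left (κ : ℝ))
  exact mul_le_mul_of_nonneg_right (Nat.cast_le.2 (hdeg x)) (ha x)

open Classical in
lemma hasSum_sum_neighbor_and_swap {f : V → V → ℂ}
    (hf : Summable fun p : V × V => if G.Adj p.1 p.2 then f p.1 p.2 else 0) :
    ∃ a, HasSum (fun x => ∑ y ∈ G.neighborFinset x, f x y) a ∧
      HasSum (fun x => ∑ y ∈ G.neighborFinset x, f y x) a := by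
  refine ⟨_, hf.hasSum.prod_fiberwise fun x => hasSum_ite_adj (f x) x, ?_⟩
  have hswap := (Equiv.prodComm V V).hasSum_iff.2 hf.hasSum
  refine hswap.prod_fiberwise fun x => ?_
  simpa only [Function.comp_apply, Equiv.prodComm_apply, Prod.swap_prod_mk, G.adj_comm]
    using hasSum_ite_adj (G := G) (fun y => f y x) x

end Neighbors

section FibreMaps

variable {k : ℕ}

lemma inner_toEuclideanLin_left (M : Mat k) (u v : Fib k) :
    inner ℂ (Matrix.toEuclideanLin M u) v = inner ℂ u (Matrix.toEuclideanLin Mᴴ v) := by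
  rw [Matrix.toEuclideanLin_conjTranspose_eq_adjoint, LinearMap.adjoint_inner_right]

lemma norm_toEuclideanLin_le (M : Mat k) (u : Fib k) :
    ‖Matrix.toEuclideanLin M u‖ ≤ ‖M‖ * ‖u‖ :=
  Matrix.l2_opNorm_mulVec M u

lemma continuous_toEuclideanLin_apply (u : Fib k) :
    Continuous fun M : Mat k => Matrix.toEuclideanLin M u :=
  ((LinearMap.applyₗ u).comp
    (Matrix.toEuclideanLin (𝕜 := ℂ) (m := Fin k) (n := Fin k)).toLinearMap
    ).continuous_of_finiteDimensional

lemma toEuclideanLin_mul_apply (M N : Mat k) (u : Fib k) :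
    Matrix.toEuclideanLin (M * N) u = Matrix.toEuclideanLin M (Matrix.toEuclideanLin N u) := by
  simp [Matrix.toLpLin_apply, Matrix.mulVec_mulVec]

lemma mat_ext {M N : Mat k} (h : ∀ u, Matrix.toEuclideanLin M u = Matrix.toEuclideanLin N u) :
    M = N :=
  Matrix.toEuclideanLin.injective (LinearMap.ext h)

end FibreMaps

/-- A Hermitian hopping `K`, bounded by `c`, on a graph of degree at most `κ`. -/
structure IsBoundedHopping {V : Type u} {k : ℕ} (G : SimpleGraph V) [G.LocallyFinite]
    (K : V → V → Mat k) (κ : ℕ) (c : ℝ) : Prop where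
  degree_le : ∀ x, G.degree x ≤ κ
  conj : ∀ x y, G.Adj x y → K y x = (K x y)ᴴ
  norm_le : ∀ x y, G.Adj x y → ‖K x y‖ ≤ c

section Hamiltonian

variable {V : Type u} {k : ℕ} {G : SimpleGraph V} [G.LocallyFinite] {K : V → V → Mat k}
  {κ : ℕ} {c g : ℝ} {W : V → Mat k} {z : ℂ}

lemma formalHam_apply (ψ : V → Fib k) (x : V) :
    formalHam G K g W ψ x = Matrix.toEuclideanLin (W x) (ψ x)
      + ((g⁻¹ : ℝ) : ℂ) • ∑ y ∈ G.neighborFinset x, Matrix.toEuclideanLin (K x y) (ψ y) :=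
  rfl

lemma mem_graph_hamiltonian_iff {ψ φ : L2 V k} :
    (ψ, φ) ∈ (hamiltonian G K g W).graph ↔ ∀ x, formalHam G K g W ψ x = φ x := by
  rw [LinearPMap.mem_graph_iff]
  constructor
  · rintro ⟨ψ', rfl, rfl⟩ x
    rfl
  · intro h
    have hdom : Memℓp (formalHam G K g W (ψ : V → Fib k)) 2 := (funext h) ▸ lp.memℓp φ
    exact ⟨⟨ψ, hdom⟩, rfl, lp.ext (funext h)⟩

lemma solves_hamiltonian_iff {ψ φ : L2 V k} :
    Solves (hamiltonian G K g W) z ψ φ ↔ ∀ x, formalHam G K g W ψ x - z • ψ x = φ x := by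
  simp only [Solves, mem_graph_hamiltonian_iff, lp.coeFn_add, lp.coeFn_smul, Pi.add_apply,
    Pi.smul_apply, sub_eq_iff_eq_add]

lemma summable_norm_sq (ψ : L2 V k) : Summable fun x => ‖ψ x‖ ^ 2 := by
  simpa using (lp.hasSum_norm (p := 2) (by simp) ψ).summable

namespace IsBoundedHopping

open Classical in
lemma summable_inner (hK : IsBoundedHopping G K κ c) (ψ φ : L2 V k) :
    Summable fun p : V × V => if G.Adj p.1 p.2 then
      (inner ℂ (Matrix.toEuclideanLin (K p.1 p.2) (ψ p.2)) (φ p.1) : ℂ) else 0 := by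
  have hψ := (Equiv.prodComm V V).summable_iff.2
    (summable_ite_adj_fst hK.degree_le (fun _ => sq_nonneg _) (summable_norm_sq ψ))
  have hφ := summable_ite_adj_fst hK.degree_le (fun _ => sq_nonneg _) (summable_norm_sq φ)
  refine Summable.of_norm_bounded ((hψ.add hφ).mul_left |c|) ?_
  rintro ⟨x, y⟩
  simp only [Function.comp_apply, Equiv.prodComm_apply, Prod.swap_prod_mk, G.adj_comm y x]
  split_ifs with h
  · calc ‖(inner ℂ (Matrix.toEuclideanLin (K x y) (ψ y)) (φ x) : ℂ)‖
        ≤ ‖K x y‖ * ‖ψ y‖ * ‖φ x‖ := (norm_inner_le_norm _ _).trans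
          (mul_le_mul_of_nonneg_right (norm_toEuclideanLin_le _ _) (norm_nonneg _))
      _ ≤ |c| * (‖ψ y‖ * ‖φ x‖) := by
        rw [mul_assoc]
        gcongr
        exact (hK.norm_le x y h).trans (le_abs_self c)
      _ ≤ |c| * (‖ψ y‖ ^ 2 + ‖φ x‖ ^ 2) := by
        gcongr
        nlinarith [sq_nonneg (‖ψ y‖ - ‖φ x‖), sq_nonneg (‖ψ y‖), sq_nonneg (‖φ x‖)]
  · simp

lemma inner_formalHam_sub_inner_formalHam (hK : IsBoundedHopping G K κ c)
    (hW : ∀ x, (W x).IsHermitian) (ψ φ : V → Fib k) (x : V) :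
    (inner ℂ (formalHam G K g W ψ x) (φ x) : ℂ) - inner ℂ (ψ x) (formalHam G K g W φ x) =
      ((g⁻¹ : ℝ) : ℂ) *
        (∑ y ∈ G.neighborFinset x, inner ℂ (Matrix.toEuclideanLin (K x y) (ψ y)) (φ x)
        - ∑ y ∈ G.neighborFinset x, inner ℂ (Matrix.toEuclideanLin (K y x) (ψ x)) (φ y)) := by
  have hconj : ∀ y ∈ G.neighborFinset x, (inner ℂ (ψ x) (Matrix.toEuclideanLin (K x y) (φ y)) : ℂ)
      = inner ℂ (Matrix.toEuclideanLin (K y x) (ψ x)) (φ y) := fun y hy => by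
    rw [inner_toEuclideanLin_left, hK.conj x y ((G.mem_neighborFinset x y).1 hy),
      Matrix.conjTranspose_conjTranspose]
  rw [formalHam_apply, formalHam_apply, inner_add_left, inner_add_right, inner_smul_left,
    inner_smul_right, inner_toEuclideanLin_left, (hW x).eq, Complex.conj_ofReal, sum_inner,
    inner_sum, Finset.sum_congr rfl hconj]
  ring

lemma inner_eq_inner_of_mem_graph_hamiltonian (hK : IsBoundedHopping G K κ c)
    (hW : ∀ x, (W x).IsHermitian) {ψ φ ψ' φ' : L2 V k}
    (h : (ψ, φ) ∈ (hamiltonian G K g W).graph) (h' : (ψ', φ') ∈ (hamiltonian G K g W).graph) :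
    (inner ℂ φ ψ' : ℂ) = inner ℂ ψ φ' := by
  obtain ⟨a, ha, ha'⟩ := hasSum_sum_neighbor_and_swap (G := G)
    (f := fun x y => inner ℂ (Matrix.toEuclideanLin (K x y) (ψ y)) (ψ' x))
    (hK.summable_inner ψ ψ')
  have hterm := fun x => hK.inner_formalHam_sub_inner_formalHam (g := g) hW ψ ψ' x
  simp only [mem_graph_hamiltonian_iff.1 h, mem_graph_hamiltonian_iff.1 h'] at hterm
  have hzero := (ha.sub ha').mul_left ((g⁻¹ : ℝ) : ℂ)
  simp only [← hterm, sub_self, mul_zero] at hzero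
  have hφ : HasSum (fun x => (inner ℂ (φ x) (ψ' x) : ℂ)) (inner ℂ φ ψ') := lp.hasSum_inner φ ψ'
  have hψ : HasSum (fun x => (inner ℂ (ψ x) (φ' x) : ℂ)) (inner ℂ ψ φ') := lp.hasSum_inner ψ φ'
  exact sub_eq_zero.1 ((hφ.sub hψ).unique hzero)

end IsBoundedHopping

open Classical in
/-- The image `H (δ_x ⊗ u)`, as a finitely supported element of `ℓ²`. -/
noncomputable def hamSingle (G : SimpleGraph V) [G.LocallyFinite] (K : V → V → Mat k) (g : ℝ)
    (W : V → Mat k) (x : V) (u : Fib k) : L2 V k :=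
  lp.single 2 x (Matrix.toEuclideanLin (W x) u) + ((g⁻¹ : ℝ) : ℂ) • ∑ y ∈ G.neighborFinset x,
    lp.single 2 y (Matrix.toEuclideanLin (K y x) u)

open Classical in
lemma single_hamSingle_mem_graph (x : V) (u : Fib k) :
    (lp.single 2 x u, hamSingle G K g W x u) ∈ (hamiltonian G K g W).graph := by
  refine mem_graph_hamiltonian_iff.2 fun y => ?_
  have hleft : ∀ y', Matrix.toEuclideanLin (K y y') ((Pi.single x u : V → Fib k) y') =
      if y' = x then Matrix.toEuclideanLin (K y x) u else 0 := fun y' => by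
    rcases eq_or_ne y' x with rfl | h <;> simp [*]
  have hright : ∀ y', (Pi.single y' (Matrix.toEuclideanLin (K y' x) u) : V → Fib k) y =
      if y' = y then Matrix.toEuclideanLin (K y x) u else 0 := fun y' => by
    rcases eq_or_ne y' y with rfl | h
    · simp
    · simp [h, h.symm]
  rw [formalHam_apply, hamSingle, lp.coeFn_add, Pi.add_apply, lp.coeFn_smul, Pi.smul_apply,
    lp.coeFn_sum, Finset.sum_apply]
  simp only [lp.coeFn_single, hleft, hright, Finset.sum_ite_eq', SimpleGraph.mem_neighborFinset,
    G.adj_comm y x]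
  congr 1
  rcases eq_or_ne y x with rfl | h <;> simp [*]

open Classical in
lemma solves_single (x : V) (u : Fib k) : Solves (hamiltonian G K g W) z (lp.single 2 x u)
    (hamSingle G K g W x u - z • lp.single 2 x u) := by
  rw [Solves, sub_add_cancel]
  exact single_hamSingle_mem_graph x u

lemma dense_domain_hamiltonian : Dense ((hamiltonian G K g W).domain : Set (L2 V k)) := by
  classical
  rw [Submodule.dense_iff_topologicalClosure_eq_top, Submodule.topologicalClosure_eq_top_iff,
    Submodule.eq_bot_iff]
  refine fun φ hφ => lp.ext (funext fun x => ext_inner_left ℂ fun u => ?_)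
  have hdom := LinearPMap.mem_domain_of_mem_graph
    (single_hamSingle_mem_graph (G := G) (K := K) (g := g) (W := W) x u)
  simpa only [lp.inner_single_left, lp.coeFn_zero, Pi.zero_apply, inner_zero_right]
    using Submodule.inner_right_of_mem_orthogonal hdom hφ

open Classical in
lemma continuous_hamSingle {X : Type*} [TopologicalSpace X] {W : X → V → Mat k}
    (hW : ∀ x, Continuous fun t => W t x) (x : V) (u : Fib k) :
    Continuous fun t => hamSingle G K g (W t) x u := by
  exact ((lp.singleContinuousLinearMap ℂ (fun _ : V => Fib k) 2 x).continuous.comp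
    ((continuous_toEuclideanLin_apply u).comp (hW x))).add continuous_const

namespace IsBoundedHopping

open Classical in
lemma inner_hamSingle (hK : IsBoundedHopping G K κ c) (hW : ∀ x, (W x).IsHermitian) (x : V)
    (u : Fib k) (φ : L2 V k) :
    inner ℂ (hamSingle G K g W x u) φ = inner ℂ u (formalHam G K g W φ x) := by
  rw [hamSingle, inner_add_left, inner_smul_left, sum_inner, lp.inner_single_left]
  simp only [formalHam_apply, lp.inner_single_left, inner_toEuclideanLin_left, (hW x).eq,
    inner_add_right, inner_smul_right, inner_sum, Complex.conj_ofReal]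
  congr 2
  refine Finset.sum_congr rfl fun y hy => ?_
  rw [hK.conj x y ((G.mem_neighborFinset x y).1 hy), Matrix.conjTranspose_conjTranspose]

open Classical in
lemma mem_graph_of_forall_inner_hamSingle (hK : IsBoundedHopping G K κ c)
    (hW : ∀ x, (W x).IsHermitian) {φ η : L2 V k}
    (h : ∀ x u, inner ℂ (hamSingle G K g W x u) φ = (inner ℂ (lp.single 2 x u) η : ℂ)) :
    (φ, η) ∈ (hamiltonian G K g W).graph := by
  refine mem_graph_hamiltonian_iff.2 fun x => ext_inner_left ℂ fun u => ?_
  rw [← hK.inner_hamSingle hW, h, lp.inner_single_left]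

theorem isSelfAdjoint_hamiltonian (hK : IsBoundedHopping G K κ c)
    (hW : ∀ x, (W x).IsHermitian) : IsSelfAdjoint (hamiltonian G K g W) := by
  classical
  have hdense := dense_domain_hamiltonian (G := G) (K := K) (g := g) (W := W)
  refine LinearPMap.isSelfAdjoint_def.2 (le_antisymm (LinearPMap.le_of_le_graph ?_)
    (LinearPMap.IsFormalAdjoint.le_adjoint hdense fun ψ φ =>
      hK.inner_eq_inner_of_mem_graph_hamiltonian hW (LinearPMap.mem_graph _ ψ)
        (LinearPMap.mem_graph _ φ)))
  rintro ⟨φ, η⟩ h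
  obtain ⟨φ, rfl, rfl⟩ := (LinearPMap.mem_graph_iff _).1 h
  refine hK.mem_graph_of_forall_inner_hamSingle hW fun x u => ?_
  obtain ⟨ψ, hψ, hHψ⟩ := (LinearPMap.mem_graph_iff _).1
    (single_hamSingle_mem_graph (G := G) (K := K) (g := g) (W := W) x u)
  have hadj := (LinearPMap.adjoint_isFormalAdjoint hdense).symm ψ φ
  rwa [hψ, hHψ] at hadj

open Classical in
lemma dense_span_hamSingle_sub (hK : IsBoundedHopping G K κ c) (hW : ∀ x, (W x).IsHermitian)
    (hz : z.im ≠ 0) :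
    Dense (Submodule.span ℂ (Set.range fun p : V × Fib k =>
      hamSingle G K g W p.1 p.2 - z • lp.single 2 p.1 p.2) : Set (L2 V k)) := by
  rw [Submodule.dense_iff_topologicalClosure_eq_top, Submodule.topologicalClosure_eq_top_iff,
    Submodule.eq_bot_iff]
  intro η hη
  have hker : Solves (hamiltonian G K g W) (starRingEnd ℂ z) η 0 := by
    refine hK.mem_graph_of_forall_inner_hamSingle hW fun x u => ?_
    have hxu := Submodule.inner_right_of_mem_orthogonal
      (Submodule.subset_span (Set.mem_range_self (x, u))) hη
    rw [inner_sub_left, inner_smul_left, sub_eq_zero] at hxu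
    rw [hxu, zero_add, inner_smul_right]
  exact hker.eq_zero (hK.isSelfAdjoint_hamiltonian hW) (by simpa using hz)

theorem continuous_resolventOp {X : Type*} [TopologicalSpace X] (hK : IsBoundedHopping G K κ c)
    {W : X → V → Mat k} (hW : ∀ t x, (W t x).IsHermitian) (hc : ∀ x, Continuous fun t => W t x)
    (hz : z.im ≠ 0) (φ : L2 V k) :
    Continuous fun t => resolventOp (hamiltonian G K g (W t)) z φ := by
  classical
  have hsa := fun t => hK.isSelfAdjoint_hamiltonian (g := g) (hW t)
  refine continuous_iff_continuousAt.2 fun t₀ => ?_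
  refine tendsto_clm_apply_of_dense_span (fun t => norm_resolventOp_le (hsa t) hz)
    (hK.dense_span_hamSingle_sub (g := g) (hW t₀) hz) ?_ φ
  rintro _ ⟨⟨x, u⟩, rfl⟩
  rw [(solves_single x u).resolventOp_eq (hsa t₀) hz]
  exact tendsto_resolventOp_of_solves hsa hz (fun t => solves_single x u)
    (((continuous_hamSingle hc x u).tendsto t₀).sub_const _)

end IsBoundedHopping

end Hamiltonian

section Green

variable {V : Type u} {k : ℕ} {G : SimpleGraph V} [G.LocallyFinite] {K : V → V → Mat k}
  {κ : ℕ} {c g : ℝ} {W : V → Mat k} {z : ℂ}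

open Classical in
lemma toEuclideanLin_kernelAt (T : L2 V k →L[ℂ] L2 V k) (x y : V) (u : Fib k) :
    Matrix.toEuclideanLin (kernelAt T x y) u = T (lp.single 2 y u) x := by
  have h : Matrix.toEuclideanLin (kernelAt T x y) =
      (lp.evalCLM ℂ (fun _ : V => Fib k) 2 x).toLinearMap ∘ₗ T.toLinearMap ∘ₗ
        (lp.singleContinuousLinearMap ℂ (fun _ : V => Fib k) 2 y).toLinearMap := by
    refine (EuclideanSpace.basisFun (Fin k) ℂ).toBasis.ext fun j => ?_
    ext i
    rw [OrthonormalBasis.coe_toBasis, EuclideanSpace.basisFun_apply]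
    exact (congrFun (Matrix.mulVec_single_one _ j) i).trans rfl
  exact DFunLike.congr_fun h u

lemma toEuclideanLin_one_apply (u : Fib k) : Matrix.toEuclideanLin (1 : Mat k) u = u := by
  simp

namespace IsBoundedHopping

open Classical in
lemma formalHam_green_sub_smul (hK : IsBoundedHopping G K κ c)
    (hW : ∀ x, (W x).IsHermitian) (hz : z.im ≠ 0) (y : V) (u : Fib k) (x : V) :
    formalHam G K g W (fun x => Matrix.toEuclideanLin (green G K g W z x y) u) x
      - z • Matrix.toEuclideanLin (green G K g W z x y) u = (Pi.single y u : V → Fib k) x := by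
  simpa only [green, toEuclideanLin_kernelAt, lp.coeFn_single] using solves_hamiltonian_iff.1
    (solves_resolventOp (hK.isSelfAdjoint_hamiltonian hW) hz (lp.single 2 y u)) x

open Classical in
lemma green_eq (hK : IsBoundedHopping G K κ c)
    (hW : ∀ x, (W x).IsHermitian) (hz : z.im ≠ 0) (x y : V) :
    (W x - z • 1) * green G K g W z x y + ((g⁻¹ : ℝ) : ℂ) • ∑ u ∈ G.neighborFinset x,
      K x u * green G K g W z u y = if x = y then 1 else 0 := by
  refine mat_ext fun u => ?_
  have h := hK.formalHam_green_sub_smul (g := g) hW hz y u x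
  rw [formalHam_apply, add_sub_right_comm] at h
  simp only [map_add, map_smul, map_sum, map_sub, LinearMap.add_apply, LinearMap.smul_apply,
    LinearMap.sum_apply, LinearMap.sub_apply, toEuclideanLin_mul_apply, toEuclideanLin_one_apply]
  rw [h]
  split_ifs with hxy
  · rw [hxy, Pi.single_eq_same, toEuclideanLin_one_apply]
  · rw [Pi.single_eq_of_ne hxy, map_zero, LinearMap.zero_apply]

-- The resolvent identity for the rank-`k` perturbation of the potential at the site `x`.
lemma green_add_green_mul_green (hK : IsBoundedHopping G K κ c) {W' : V → Mat k}
    (hW : ∀ x, (W x).IsHermitian) (hW' : ∀ x, (W' x).IsHermitian) (hz : z.im ≠ 0) {x : V}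
    {M : Mat k} (hx : W' x = W x + M) (hne : ∀ y, y ≠ x → W' y = W y) (y : V) :
    green G K g W' z x y + green G K g W z x x * M * green G K g W' z x y =
      green G K g W z x y := by
  classical
  refine mat_ext fun u => ?_
  set φ : L2 V k := lp.single 2 y u
  set ψ := resolventOp (hamiltonian G K g W') z φ with hψ
  have hsol' := solves_hamiltonian_iff.1
    (solves_resolventOp (hK.isSelfAdjoint_hamiltonian (g := g) hW') hz φ)
  have hsol : Solves (hamiltonian G K g W) z ψ
      (φ - lp.single 2 x (Matrix.toEuclideanLin M (ψ x))) := by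
    refine solves_hamiltonian_iff.2 fun y' => ?_
    rw [lp.coeFn_sub, Pi.sub_apply, ← hsol' y', formalHam_apply, formalHam_apply, lp.coeFn_single]
    rcases eq_or_ne y' x with rfl | hy
    · rw [hx, map_add, LinearMap.add_apply, Pi.single_eq_same, ← hψ]
      abel
    · rw [hne y' hy, Pi.single_eq_of_ne hy, sub_zero, ← hψ]
  have heq := hsol.resolventOp_eq (hK.isSelfAdjoint_hamiltonian hW) hz
  rw [map_sub, sub_eq_iff_eq_add] at heq
  simp only [green, map_add, LinearMap.add_apply, toEuclideanLin_mul_apply,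
    toEuclideanLin_kernelAt]
  exact (congrFun (congrArg Subtype.val heq) x).symm

lemma det_one_add_green_mul_ne_zero (hK : IsBoundedHopping G K κ c) {W' : V → Mat k}
    (hW : ∀ x, (W x).IsHermitian) (hW' : ∀ x, (W' x).IsHermitian) (hz : z.im ≠ 0) {x : V}
    {M : Mat k} (hx : W' x = W x + M) (hne : ∀ y, y ≠ x → W' y = W y) :
    (1 + green G K g W z x x * M).det ≠ 0 := by
  have hinv : (1 + green G K g W z x x * M) * (1 - green G K g W' z x x * M) = 1 := by
    calc _ = 1 + (green G K g W z x x - (green G K g W' z x x +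
          green G K g W z x x * M * green G K g W' z x x)) * M := by noncomm_ring
      _ = 1 := by
        rw [hK.green_add_green_mul_green hW hW' hz hx hne, sub_self, zero_mul, add_zero]
  exact Matrix.det_ne_zero_of_right_inverse hinv

end IsBoundedHopping

end Green

section LinearPencil

open Polynomial

variable {R n : Type*} [CommRing R] [Fintype n] [DecidableEq n]

/-- The linear matrix pencil `1 + t N`, as a matrix of polynomials in `t`. -/
noncomputable def linearPencil (N : Matrix n n R) : Matrix n n R[X] :=
  (X : R[X]) • N.map C + (1 : Matrix n n R).map C

lemma mapMatrix_evalRingHom_linearPencil (N : Matrix n n R) (t : R) :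
    (evalRingHom t).mapMatrix (linearPencil N) = 1 + t • N := by
  ext i j
  rw [RingHom.mapMatrix_apply, Matrix.map_apply, linearPencil, Matrix.add_apply,
    Matrix.smul_apply, Matrix.map_apply, Matrix.map_apply, coe_evalRingHom, eval_add, smul_eq_mul,
    eval_mul, eval_X, eval_C, eval_C, Matrix.add_apply, Matrix.smul_apply, smul_eq_mul, add_comm]

lemma eval_det_linearPencil (N : Matrix n n R) (t : R) :
    (linearPencil N).det.eval t = (1 + t • N).det := by
  rw [← mapMatrix_evalRingHom_linearPencil, ← RingHom.map_det, coe_evalRingHom]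

lemma eval_adjugate_linearPencil (N : Matrix n n R) (t : R) (i j : n) :
    ((linearPencil N).adjugate i j).eval t = (1 + t • N).adjugate i j := by
  rw [← mapMatrix_evalRingHom_linearPencil, ← RingHom.map_adjugate]
  rfl

lemma natDegree_det_linearPencil_le (N : Matrix n n R) :
    (linearPencil N).det.natDegree ≤ Fintype.card n :=
  natDegree_det_X_add_C_le _ _

lemma natDegree_adjugate_linearPencil_le {m : ℕ} (N : Matrix (Fin (m + 1)) (Fin (m + 1)) R)
    (i j : Fin (m + 1)) : ((linearPencil N).adjugate i j).natDegree ≤ m := by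
  rw [Matrix.adjugate_fin_succ_eq_det_submatrix]
  have hminor : (linearPencil N).submatrix j.succAbove i.succAbove =
      (X : R[X]) • (N.submatrix j.succAbove i.succAbove).map C +
        ((1 : Matrix _ _ R).submatrix j.succAbove i.succAbove).map C := rfl
  have hsign : (-1 : R[X]) ^ ((j : ℕ) + (i : ℕ)) = C ((-1) ^ ((j : ℕ) + (i : ℕ))) := by simp
  rw [hminor, hsign]
  refine (natDegree_C_mul_le _ _).trans ((natDegree_det_X_add_C_le _ _).trans ?_)
  rw [Fintype.card_fin]

lemma exists_polynomial_of_linearPencil {𝕜 : Type*} [Field 𝕜] {m : ℕ}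
    (N F : Matrix (Fin (m + 1)) (Fin (m + 1)) 𝕜) :
    ∃ (p : Fin (m + 1) → Fin (m + 1) → 𝕜[X]) (Q : 𝕜[X]), (∀ i j, (p i j).natDegree ≤ m) ∧
      Q.natDegree ≤ m + 1 ∧ (∀ t, Q.eval t = (1 + t • N).det) ∧
      ∀ (t : 𝕜) (Y : Matrix (Fin (m + 1)) (Fin (m + 1)) 𝕜), (1 + t • N).det ≠ 0 →
        (1 + t • N) * Y = F → ∀ i j, Y i j = (p i j).eval t / Q.eval t := by
  refine ⟨fun i j => ∑ l, (linearPencil N).adjugate i l * C (F l j), (linearPencil N).det,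
    fun i j => ?_, (natDegree_det_linearPencil_le N).trans_eq (Fintype.card_fin _),
    eval_det_linearPencil N, fun t Y hdet hY i j => ?_⟩
  · exact natDegree_sum_le_of_forall_le _ _ fun l _ =>
      (natDegree_mul_C_le _ _).trans (natDegree_adjugate_linearPencil_le N i l)
  · have hcramer : (1 + t • N).adjugate * F = (1 + t • N).det • Y := by
      rw [← hY, ← Matrix.mul_assoc, Matrix.adjugate_mul, Matrix.smul_mul, Matrix.one_mul]
    rw [eval_det_linearPencil, eq_div_iff hdet, mul_comm, ← smul_eq_mul, ← Matrix.smul_apply,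
      ← hcramer, Matrix.mul_apply, eval_finsetSum]
    simp only [eval_mul, eval_C, eval_adjugate_linearPencil]

end LinearPencil

section Distribution

lemma HasMomentBound.exists_tail_le {q C : ℝ} (hq : 0 < q) {η : ℝ} (hη : 0 < η) :
    ∃ R : ℝ, 0 < R ∧ ∀ μ : Measure ℝ, HasMomentBound μ q C →
      μ {t | R < |t|} ≤ ENNReal.ofReal η := by
  set R := (|C| / η + 1) ^ (1 / q) with hR
  have hR0 : 0 < R := by positivity
  have hRq : R ^ q = |C| / η + 1 := by
    rw [hR, ← Real.rpow_mul (by positivity), one_div_mul_cancel hq.ne', Real.rpow_one]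
  refine ⟨R, hR0, fun μ h => ?_⟩
  have hmarkov : ENNReal.ofReal (R ^ q) * μ {t | R < |t|} ≤ ENNReal.ofReal C := by
    refine le_trans ?_ ((mul_meas_ge_le_lintegral (μ := μ)
      (f := fun t : ℝ => ENNReal.ofReal (|t| ^ q)) (by fun_prop) (ENNReal.ofReal (R ^ q))).trans h)
    gcongr
    intro ht
    exact ENNReal.ofReal_le_ofReal (Real.rpow_le_rpow hR0.le (le_of_lt ht) hq.le)
  have hC : C ≤ R ^ q * η := by
    rw [hRq, add_mul, div_mul_cancel₀ _ hη.ne']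
    linarith [le_abs_self C]
  have hle := hmarkov.trans (ENNReal.ofReal_le_ofReal hC)
  rw [ENNReal.ofReal_mul (by positivity)] at hle
  exact (ENNReal.mul_le_mul_iff_right (ENNReal.ofReal_pos.2 (by positivity)).ne'
    ENNReal.ofReal_ne_top).1 hle

lemma one_add_rpow_le {q t : ℝ} (hq : 0 ≤ q) (ht : 0 ≤ t) :
    (1 + t) ^ q ≤ 2 ^ q * (1 + t ^ q) := by
  calc (1 + t) ^ q ≤ (2 * max 1 t) ^ q := by
        gcongr
        linarith [le_max_left 1 t, le_max_right 1 t]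
    _ = 2 ^ q * (max 1 t) ^ q := Real.mul_rpow (by positivity) (by positivity)
    _ ≤ 2 ^ q * (1 + t ^ q) := by
      gcongr
      have htq : 0 ≤ t ^ q := by positivity
      rcases max_choice 1 t with h | h <;> rw [h]
      · rw [Real.one_rpow]
        linarith
      · linarith

lemma HasMomentBound.exists_lintegral_one_add_le {q C : ℝ} (hq : 0 < q) :
    ∃ M : ℝ, 0 ≤ M ∧ ∀ μ : Measure ℝ, IsProbabilityMeasure μ → HasMomentBound μ q C →
      ∫⁻ t, ENNReal.ofReal ((1 + |t|) ^ q) ∂μ ≤ ENNReal.ofReal M := by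
  refine ⟨2 ^ q * (1 + |C|), by positivity, fun μ _ h => ?_⟩
  calc ∫⁻ t, ENNReal.ofReal ((1 + |t|) ^ q) ∂μ
      ≤ ∫⁻ t, ENNReal.ofReal (2 ^ q) * (1 + ENNReal.ofReal (|t| ^ q)) ∂μ := by
        refine lintegral_mono fun t => ?_
        rw [← ENNReal.ofReal_one, ← ENNReal.ofReal_add (by positivity) (by positivity),
          ← ENNReal.ofReal_mul (by positivity)]
        exact ENNReal.ofReal_le_ofReal (one_add_rpow_le hq.le (abs_nonneg t))
    _ = ENNReal.ofReal (2 ^ q) * (1 + ∫⁻ t, ENNReal.ofReal (|t| ^ q) ∂μ) := by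
      rw [lintegral_const_mul _ (by fun_prop), lintegral_add_left (by fun_prop), lintegral_const,
        measure_univ, mul_one]
    _ ≤ ENNReal.ofReal (2 ^ q) * (ENNReal.ofReal 1 + ENNReal.ofReal |C|) := by
      rw [ENNReal.ofReal_one]
      gcongr
      exact h.trans (ENNReal.ofReal_le_ofReal (le_abs_self C))
    _ = _ := by
      rw [← ENNReal.ofReal_add (by positivity) (by positivity), ENNReal.ofReal_mul (by positivity)]

namespace IsAlphaRegular

lemma measure_ball_le {μ : Measure ℝ} {α C : ℝ} (h : IsAlphaRegular μ α C) (b : ℂ)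
    {δ : ℝ} (hδ : 0 < δ) : μ {t : ℝ | ‖(t : ℂ) - b‖ ≤ δ} ≤ ENNReal.ofReal (C * δ ^ α) := by
  refine (measure_mono fun t ht => ?_).trans (h b.re δ hδ)
  have hre : |t - b.re| ≤ δ := by
    simpa only [Complex.sub_re, Complex.ofReal_re] using
      (Complex.abs_re_le_norm ((t : ℂ) - b)).trans ht
  rw [abs_le] at hre
  exact ⟨by linarith, by linarith⟩

lemma exists_ball_le {α C : ℝ} (hα : 0 < α) {η : ℝ} (hη : 0 < η) :
    ∃ δ : ℝ, 0 < δ ∧ ∀ μ : Measure ℝ, IsAlphaRegular μ α C → ∀ b : ℂ,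
      μ {t : ℝ | ‖(t : ℂ) - b‖ ≤ δ} ≤ ENNReal.ofReal η := by
  refine ⟨(η / (|C| + 1)) ^ (1 / α), by positivity, fun μ h b => ?_⟩
  refine (h.measure_ball_le b (by positivity)).trans (ENNReal.ofReal_le_ofReal ?_)
  rw [← Real.rpow_mul (by positivity), one_div_mul_cancel hα.ne', Real.rpow_one,
    mul_div_assoc', div_le_iff₀ (by positivity)]
  nlinarith [le_abs_self C]

end IsAlphaRegular

lemma rpow_one_add_inv_le_tsum {β : ℝ} (hβ : 0 < β) (r : ℝ) (hr : 0 ≤ r) :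
    ENNReal.ofReal ((1 + 1 / r) ^ β) ≤ ENNReal.ofReal (2 ^ β) +
      ∑' n : ℕ, if r ≤ (1 / 2) ^ n then ENNReal.ofReal ((2 ^ β) ^ (n + 2)) else 0 := by
  rcases hr.eq_or_lt with rfl | hr
  · refine le_add_right (ENNReal.ofReal_le_ofReal ?_)
    gcongr
    norm_num
  rcases le_or_gt r 1 with hr1 | hr1
  · obtain ⟨n, hn, hn'⟩ := exists_nat_pow_near_of_lt_one hr hr1 (show (0 : ℝ) < 1 / 2 by norm_num)
      (by norm_num)
    refine le_add_left (le_trans ?_ (ENNReal.le_tsum n))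
    rw [if_pos hn']
    refine ENNReal.ofReal_le_ofReal ?_
    rw [← Real.rpow_natCast, ← Real.rpow_mul (by norm_num), mul_comm β,
      Real.rpow_mul (by norm_num), Real.rpow_natCast]
    gcongr
    have hinv : 1 / r ≤ 2 ^ (n + 1) := by
      rw [one_div_pow] at hn
      exact (one_div_lt (by positivity) hr).1 hn |>.le
    have hone : (1 : ℝ) ≤ 2 ^ (n + 1) := one_le_pow₀ (by norm_num)
    rw [pow_succ _ (n + 1)]
    linarith
  · refine le_add_right (ENNReal.ofReal_le_ofReal ?_)
    gcongr
    rw [← one_add_one_eq_two]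
    gcongr
    exact (div_le_one hr).2 hr1.le

lemma summable_rpow_pow_mul_half_pow_rpow {α β : ℝ} (hβα : β < α) (C : ℝ) :
    Summable fun n : ℕ => ((2 : ℝ) ^ β) ^ (n + 2) * (C * ((1 / 2) ^ n) ^ α) := by
  have hratio : (2 : ℝ) ^ (β - α) < 1 :=
    Real.rpow_lt_one_of_one_lt_of_neg (by norm_num) (by linarith)
  have hterm : ∀ n : ℕ, ((2 : ℝ) ^ β) ^ (n + 2) * (C * ((1 / 2) ^ n) ^ α) =
      (2 ^ β) ^ 2 * C * ((2 : ℝ) ^ (β - α)) ^ n := fun n => by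
    have hα : (((1 : ℝ) / 2) ^ n) ^ α = ((2 : ℝ) ^ (-α)) ^ n := by
      rw [← Real.rpow_pow_comm (by norm_num), one_div, Real.inv_rpow (by norm_num),
        Real.rpow_neg (by norm_num)]
    rw [hα, sub_eq_add_neg, Real.rpow_add (by norm_num), mul_pow, pow_add]
    ring
  simp only [hterm]
  exact (summable_geometric_of_lt_one (by positivity) hratio).mul_left _

namespace IsAlphaRegular

lemma lintegral_inv_le_tsum {μ : Measure ℝ} [IsProbabilityMeasure μ] {α β C : ℝ} (hβ : 0 < β)
    (h : IsAlphaRegular μ α C) (b : ℂ) :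
    ∫⁻ t : ℝ, ENNReal.ofReal ((1 + 1 / ‖(t : ℂ) - b‖) ^ β) ∂μ ≤ ENNReal.ofReal (2 ^ β) +
      ∑' n : ℕ, ENNReal.ofReal ((2 ^ β) ^ (n + 2) * (|C| * ((1 / 2) ^ n) ^ α)) := by
  have hmeas : ∀ r : ℝ, MeasurableSet {t : ℝ | ‖(t : ℂ) - b‖ ≤ r} := fun r =>
    measurableSet_le (by fun_prop) measurable_const
  calc ∫⁻ t : ℝ, ENNReal.ofReal ((1 + 1 / ‖(t : ℂ) - b‖) ^ β) ∂μ
      ≤ ∫⁻ t : ℝ, (ENNReal.ofReal (2 ^ β) + ∑' n : ℕ, if ‖(t : ℂ) - b‖ ≤ (1 / 2) ^ n then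
          ENNReal.ofReal ((2 ^ β) ^ (n + 2)) else 0) ∂μ :=
        lintegral_mono fun t => rpow_one_add_inv_le_tsum hβ _ (norm_nonneg _)
    _ = ENNReal.ofReal (2 ^ β) + ∑' n : ℕ, ENNReal.ofReal ((2 ^ β) ^ (n + 2)) *
          μ {t : ℝ | ‖(t : ℂ) - b‖ ≤ (1 / 2) ^ n} := by
        rw [lintegral_add_left measurable_const, lintegral_const, measure_univ, mul_one,
          lintegral_tsum fun n => (Measurable.ite (hmeas _) measurable_const
            measurable_const).aemeasurable]
        simp only [← lintegral_indicator_const (hmeas _), Set.indicator_apply, Set.mem_ofPred_eq]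
    _ ≤ _ := by
        gcongr with n
        rw [ENNReal.ofReal_mul (by positivity)]
        gcongr
        refine (h.measure_ball_le b (by positivity)).trans (ENNReal.ofReal_le_ofReal ?_)
        gcongr
        exact le_abs_self C

lemma exists_lintegral_inv_le {α β C : ℝ} (hβ : 0 < β) (hβα : β < α) :
    ∃ M : ℝ, 0 ≤ M ∧ ∀ μ : Measure ℝ, IsProbabilityMeasure μ → IsAlphaRegular μ α C → ∀ b : ℂ,
      ∫⁻ t : ℝ, ENNReal.ofReal ((1 + 1 / ‖(t : ℂ) - b‖) ^ β) ∂μ ≤ ENNReal.ofReal M := by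
  have hnonneg : ∀ n : ℕ, 0 ≤ ((2 : ℝ) ^ β) ^ (n + 2) * (|C| * ((1 / 2) ^ n) ^ α) :=
    fun n => by positivity
  refine ⟨2 ^ β + ∑' n : ℕ, (2 ^ β) ^ (n + 2) * (|C| * ((1 / 2) ^ n) ^ α),
    add_nonneg (by positivity) (tsum_nonneg hnonneg), fun μ _ h b => ?_⟩
  rw [ENNReal.ofReal_add (by positivity) (tsum_nonneg hnonneg),
    ENNReal.ofReal_tsum_of_nonneg hnonneg (summable_rpow_pow_mul_half_pow_rpow hβα _)]
  exact h.lintegral_inv_le_tsum hβ b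

lemma measure_le_ediam_rpow {μ : Measure ℝ} {α C : ℝ} (hα : 0 < α) (h : IsAlphaRegular μ α C)
    {s : Set ℝ} (hs : Metric.ediam s ≠ ⊤) :
    μ s ≤ ENNReal.ofReal C * Metric.ediam s ^ α := by
  rcases s.eq_empty_or_nonempty with rfl | ⟨t, ht⟩
  · simp
  have hlarge : ∀ ε, Metric.diam s < ε → μ s ≤ ENNReal.ofReal (C * ε ^ α) := fun ε hε => by
    refine (measure_mono fun u hu => ?_).trans (h t ε (Metric.diam_nonneg.trans_lt hε))
    rw [← Real.closedBall_eq_Icc]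
    exact (Metric.dist_le_diam_of_mem' hs hu ht).trans hε.le
  have hlim : Tendsto (fun ε => ENNReal.ofReal (C * ε ^ α)) (𝓝[>] Metric.diam s)
      (𝓝 (ENNReal.ofReal (C * Metric.diam s ^ α))) :=
    ENNReal.tendsto_ofReal (((Real.continuous_rpow_const hα.le).tendsto _).const_mul C
      |>.mono_left nhdsWithin_le_nhds)
  refine (ge_of_tendsto hlim (eventually_nhdsWithin_of_forall hlarge)).trans_eq ?_
  rw [mul_comm, ENNReal.ofReal_mul (by positivity), mul_comm,
    ← ENNReal.ofReal_rpow_of_nonneg Metric.diam_nonneg hα.le, Metric.diam, ENNReal.ofReal_toReal hs]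

-- For `α > 1` the measure would be dominated by the Hausdorff measure of dimension `α`,
-- which vanishes on the line.
lemma exponent_le_one {μ : Measure ℝ} [IsProbabilityMeasure μ] {α C : ℝ}
    (h : IsAlphaRegular μ α C) : α ≤ 1 := by
  by_contra! hα
  set a := ENNReal.ofReal (|C| + 1) with ha
  have ha0 : a ≠ 0 := (ENNReal.ofReal_pos.2 (by positivity)).ne'
  have hle : a⁻¹ • μ ≤ Measure.hausdorffMeasure α := by
    refine Measure.le_hausdorffMeasure α _ 1 one_pos fun s hs => ?_
    rw [Measure.smul_apply, smul_eq_mul, ENNReal.inv_mul_le_iff ha0 ENNReal.ofReal_ne_top]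
    refine (h.measure_le_ediam_rpow (by linarith) (hs.trans_lt ENNReal.one_lt_top).ne).trans ?_
    gcongr
    exact ENNReal.ofReal_le_ofReal (by linarith [le_abs_self C])
  have hdim : dimH (Set.univ : Set ℝ) < α.toNNReal := by
    rw [Real.dimH_univ]
    exact_mod_cast Real.one_lt_toNNReal.2 hα
  have hzero := hausdorffMeasure_of_dimH_lt hdim
  rw [Real.coe_toNNReal α (by linarith)] at hzero
  have huniv := (hle Set.univ).trans_eq hzero
  simp [ha] at huniv

end IsAlphaRegular

end Distribution

section RationalFunctions

open Polynomial

/-- A size of a complex polynomial, multiplicative in its linear factors, comparable to its values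
at real points of order one that are not too close to the roots. -/
noncomputable def rootSize (p : ℂ[X]) : ℝ :=
  ‖p.leadingCoeff‖ * (p.roots.map fun a => 1 + ‖a‖).prod

/-- The factor by which `p` can be smaller than its `rootSize` near its roots. By the convention
`1 / 0 = 0` the roots equal to `t` itself contribute a factor `1`. -/
noncomputable def rootProximity (p : ℂ[X]) (t : ℝ) : ℝ :=
  (p.roots.map fun a => 1 + 1 / ‖(t : ℂ) - a‖).prod

/-- The real points of modulus more than `R` or within distance `δ` of a root of `p`. -/
def badPoints (p : ℂ[X]) (R δ : ℝ) : Set ℝ :=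
  {t | R < |t|} ∪ ⋃ a ∈ p.roots.toFinset, {t : ℝ | ‖(t : ℂ) - a‖ ≤ δ}

lemma norm_eval_eq (p : ℂ[X]) (t : ℂ) :
    ‖p.eval t‖ = ‖p.leadingCoeff‖ * (p.roots.map fun a => ‖t - a‖).prod := by
  rw [(IsAlgClosed.splits p).eval_eq_prod_roots, norm_mul]
  congr 1
  have hprod := map_multiset_prod (normHom (α := ℂ)) (p.roots.map fun a => t - a)
  simpa [Multiset.map_map] using hprod

lemma prod_map_roots_const (p : ℂ[X]) (r : ℝ) :
    (p.roots.map fun _ => r).prod = r ^ p.natDegree := by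
  rw [Multiset.map_const', Multiset.prod_replicate, splits_iff_card_roots.1 (IsAlgClosed.splits p)]

lemma rootSize_pos {p : ℂ[X]} (hp : p ≠ 0) : 0 < rootSize p := by
  refine mul_pos (norm_pos_iff.2 (leadingCoeff_ne_zero.2 hp)) (Multiset.prod_pos ?_)
  intro x hx
  obtain ⟨a, _, rfl⟩ := Multiset.mem_map.1 hx
  positivity

lemma rootProximity_nonneg (p : ℂ[X]) (t : ℝ) : 0 ≤ rootProximity p t :=
  Multiset.prod_nonneg fun x hx => by
    obtain ⟨a, _, rfl⟩ := Multiset.mem_map.1 hx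
    positivity

lemma norm_eval_le_rootSize {p : ℂ[X]} {d : ℕ} (hd : p.natDegree ≤ d) (t : ℝ) :
    ‖p.eval (t : ℂ)‖ ≤ rootSize p * (1 + |t|) ^ d := by
  have hmono : (1 + |t|) ^ p.natDegree ≤ (1 + |t|) ^ d :=
    pow_le_pow_right₀ (by linarith [abs_nonneg t]) hd
  rw [norm_eval_eq, rootSize, mul_assoc]
  gcongr
  calc (p.roots.map fun a => ‖(t : ℂ) - a‖).prod
      ≤ (p.roots.map fun a => (1 + ‖a‖) * (1 + |t|)).prod := by
        refine Multiset.prod_map_le_prod_map₀ _ _ (fun a _ => norm_nonneg _) fun a _ => ?_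
        have htri : ‖(t : ℂ) - a‖ ≤ |t| + ‖a‖ := by
          refine (norm_sub_le _ _).trans ?_
          rw [Complex.norm_real, Real.norm_eq_abs]
        nlinarith [norm_nonneg a, abs_nonneg t]
    _ = (p.roots.map fun a => 1 + ‖a‖).prod * (1 + |t|) ^ p.natDegree := by
        rw [Multiset.prod_map_mul, prod_map_roots_const]
    _ ≤ (p.roots.map fun a => 1 + ‖a‖).prod * (1 + |t|) ^ d := by
        refine mul_le_mul_of_nonneg_left hmono (Multiset.prod_nonneg fun x hx => ?_)
        obtain ⟨a, _, rfl⟩ := Multiset.mem_map.1 hx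
        positivity

lemma rootSize_le_mul_norm_eval {p : ℂ[X]} {d : ℕ} (hd : p.natDegree ≤ d) {t : ℝ}
    (ht : p.eval (t : ℂ) ≠ 0) :
    rootSize p ≤ ‖p.eval (t : ℂ)‖ * ((1 + |t|) ^ d * rootProximity p t) := by
  have hp : p ≠ 0 := fun h => ht (by simp [h])
  have hmono : (1 + |t|) ^ p.natDegree ≤ (1 + |t|) ^ d :=
    pow_le_pow_right₀ (by linarith [abs_nonneg t]) hd
  suffices h : rootSize p ≤ ‖p.eval (t : ℂ)‖ * ((1 + |t|) ^ p.natDegree * rootProximity p t) from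
    h.trans (mul_le_mul_of_nonneg_left
      (mul_le_mul_of_nonneg_right hmono (rootProximity_nonneg p t)) (norm_nonneg _))
  rw [norm_eval_eq, rootSize, rootProximity, mul_assoc, ← prod_map_roots_const,
    ← Multiset.prod_map_mul, ← Multiset.prod_map_mul]
  gcongr
  refine Multiset.prod_map_le_prod_map₀ _ _ (fun a _ => by positivity) fun a ha => ?_
  have hne : 0 < ‖(t : ℂ) - a‖ := by
    rw [norm_pos_iff, sub_ne_zero]
    rintro rfl
    exact ht ((mem_roots hp).1 ha)
  have htri : ‖a‖ ≤ |t| + ‖(t : ℂ) - a‖ := by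
    have h := norm_sub_le (t : ℂ) ((t : ℂ) - a)
    rwa [sub_sub_cancel, Complex.norm_real, Real.norm_eq_abs] at h
  calc 1 + ‖a‖ ≤ (1 + |t|) * (‖(t : ℂ) - a‖ + 1) := by
        nlinarith [abs_nonneg t, mul_nonneg (abs_nonneg t) hne.le]
    _ = ‖(t : ℂ) - a‖ * ((1 + |t|) * (1 + 1 / ‖(t : ℂ) - a‖)) := by field_simp

lemma norm_eval_div_eval_le {p Q : ℂ[X]} (hQ : Q ≠ 0) {d m : ℕ} (hd : p.natDegree ≤ d)
    (hm : Q.natDegree ≤ m) (t : ℝ) :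
    ‖p.eval (t : ℂ) / Q.eval (t : ℂ)‖ ≤
      rootSize p / rootSize Q * ((1 + |t|) ^ (d + m) * rootProximity Q t) := by
  have hprox := rootProximity_nonneg Q t
  have hsize : 0 ≤ rootSize p := by
    rcases eq_or_ne p 0 with rfl | hp
    · simp [rootSize]
    · exact (rootSize_pos hp).le
  have hsizeQ := rootSize_pos hQ
  rcases eq_or_ne (Q.eval (t : ℂ)) 0 with h0 | h0
  · rw [h0, div_zero, norm_zero]
    positivity
  rw [norm_div, div_le_iff₀ (norm_pos_iff.2 h0), div_mul_eq_mul_div, div_mul_eq_mul_div,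
    le_div_iff₀ hsizeQ]
  calc ‖p.eval (t : ℂ)‖ * rootSize Q
      ≤ (rootSize p * (1 + |t|) ^ d) *
          (‖Q.eval (t : ℂ)‖ * ((1 + |t|) ^ m * rootProximity Q t)) :=
        mul_le_mul (norm_eval_le_rootSize hd t) (rootSize_le_mul_norm_eval hm h0) hsizeQ.le
          (by positivity)
    _ = rootSize p * ((1 + |t|) ^ (d + m) * rootProximity Q t) * ‖Q.eval (t : ℂ)‖ := by ring

lemma abs_le_of_notMem_badPoints {p : ℂ[X]} {R δ t : ℝ} (ht : t ∉ badPoints p R δ) : |t| ≤ R :=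
  not_lt.1 fun h => ht (Or.inl h)

lemma lt_norm_sub_of_notMem_badPoints {p : ℂ[X]} {R δ t : ℝ} (ht : t ∉ badPoints p R δ) {a : ℂ}
    (ha : a ∈ p.roots) : δ < ‖(t : ℂ) - a‖ :=
  not_le.1 fun h => ht (Or.inr (Set.mem_biUnion (Multiset.mem_toFinset.2 ha) h))

lemma measurableSet_badPoints (p : ℂ[X]) (R δ : ℝ) : MeasurableSet (badPoints p R δ) :=
  (measurableSet_lt measurable_const (by fun_prop)).union <|
    Finset.measurableSet_biUnion _ fun _ _ => measurableSet_le (by fun_prop) measurable_const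

lemma measure_badPoints_le {μ : Measure ℝ} {p : ℂ[X]} {n : ℕ} (hn : p.natDegree ≤ n) {R δ : ℝ}
    {η η' : ℝ≥0∞} (htail : μ {t | R < |t|} ≤ η)
    (hball : ∀ b : ℂ, μ {t : ℝ | ‖(t : ℂ) - b‖ ≤ δ} ≤ η') :
    μ (badPoints p R δ) ≤ η + n * η' := by
  refine (measure_union_le _ _).trans (add_le_add htail ?_)
  calc μ (⋃ a ∈ p.roots.toFinset, {t : ℝ | ‖(t : ℂ) - a‖ ≤ δ})
      ≤ ∑ _ ∈ p.roots.toFinset, η' :=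
        (measure_biUnion_finset_le _ _).trans (Finset.sum_le_sum fun a _ => hball a)
    _ ≤ n * η' := by
        rw [Finset.sum_const, nsmul_eq_mul]
        gcongr
        exact (Multiset.toFinset_card_le _).trans ((card_roots' p).trans hn)

lemma badPoints_subset_mul_left {p Q : ℂ[X]} (hpQ : p * Q ≠ 0) (R δ : ℝ) :
    badPoints p R δ ⊆ badPoints (p * Q) R δ := by
  refine Set.union_subset_union_right _ (Set.biUnion_subset_biUnion_left fun a ha => ?_)
  rw [Finset.mem_coe, Multiset.mem_toFinset] at ha ⊢
  exact Multiset.mem_of_le (roots.le_of_dvd hpQ (dvd_mul_right p Q)) ha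

lemma eval_ne_zero_of_notMem_badPoints {p : ℂ[X]} (hp : p ≠ 0) {R δ t : ℝ} (hδ : 0 < δ)
    (ht : t ∉ badPoints p R δ) : p.eval (t : ℂ) ≠ 0 := fun h0 => by
  have h := lt_norm_sub_of_notMem_badPoints ht ((mem_roots hp).2 h0)
  rw [sub_self, norm_zero] at h
  exact hδ.not_gt h

lemma rootProximity_le_of_notMem_badPoints {p : ℂ[X]} {d : ℕ} (hd : p.natDegree ≤ d) {R δ t : ℝ}
    (hδ : 0 < δ) (ht : t ∉ badPoints p R δ) : rootProximity p t ≤ (1 + 1 / δ) ^ d := by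
  calc rootProximity p t ≤ (p.roots.map fun _ => 1 + 1 / δ).prod := by
        refine Multiset.prod_map_le_prod_map₀ _ _ (fun a _ => by positivity) fun a ha => ?_
        have hle := (lt_norm_sub_of_notMem_badPoints ht ha).le
        gcongr
    _ = (1 + 1 / δ) ^ p.natDegree := prod_map_roots_const p _
    _ ≤ (1 + 1 / δ) ^ d := pow_le_pow_right₀ (by linarith [show 0 < 1 / δ by positivity]) hd

lemma rootSize_div_rootSize_le {p Q : ℂ[X]} (hp : p ≠ 0) (hQ : Q ≠ 0) {d m : ℕ}
    (hd : p.natDegree ≤ d) (hm : Q.natDegree ≤ m) {R δ t : ℝ} (hδ : 0 < δ)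
    (ht : t ∉ badPoints (p * Q) R δ) :
    rootSize p / rootSize Q ≤
      ‖p.eval (t : ℂ) / Q.eval (t : ℂ)‖ * ((1 + R) ^ (d + m) * (1 + 1 / δ) ^ d) := by
  have hpQ := mul_ne_zero hp hQ
  have htp : t ∉ badPoints p R δ := fun h => ht (badPoints_subset_mul_left hpQ R δ h)
  have htQ : t ∉ badPoints Q R δ := fun h =>
    ht (mul_comm p Q ▸ badPoints_subset_mul_left (mul_comm p Q ▸ hpQ) R δ h)
  have hQt := eval_ne_zero_of_notMem_badPoints hQ hδ htQ
  have hR := abs_le_of_notMem_badPoints ht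
  have hprox := rootProximity_nonneg p t
  have hsizeQ := rootSize_pos hQ
  rw [norm_div, div_mul_eq_mul_div, div_le_div_iff₀ hsizeQ (norm_pos_iff.2 hQt)]
  calc rootSize p * ‖Q.eval (t : ℂ)‖
      ≤ (‖p.eval (t : ℂ)‖ * ((1 + |t|) ^ d * rootProximity p t)) *
          (rootSize Q * (1 + |t|) ^ m) :=
        mul_le_mul (rootSize_le_mul_norm_eval hd (eval_ne_zero_of_notMem_badPoints hp hδ htp))
          (norm_eval_le_rootSize hm t) (norm_nonneg _) (by positivity)
    _ ≤ (‖p.eval (t : ℂ)‖ * ((1 + R) ^ d * (1 + 1 / δ) ^ d)) * (rootSize Q * (1 + R) ^ m) := by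
        have hle := rootProximity_le_of_notMem_badPoints hd hδ htp
        have hR0 : 0 ≤ R := (abs_nonneg t).trans hR
        gcongr
    _ = ‖p.eval (t : ℂ)‖ * ((1 + R) ^ (d + m) * (1 + 1 / δ) ^ d) * rootSize Q := by ring

end RationalFunctions

section Decoupling

open Polynomial

lemma le_add_rpow_div {X L P : ℝ} (hX : 0 ≤ X) (hL : 0 < L) (hP : 1 ≤ P) :
    X ≤ L + X ^ P / L ^ (P - 1) := by
  rcases le_or_gt X L with h | h
  · have hnonneg : 0 ≤ X ^ P / L ^ (P - 1) := by positivity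
    linarith
  · suffices X ≤ X ^ P / L ^ (P - 1) by linarith
    have hXpos : 0 < X := hL.trans h
    rw [le_div_iff₀ (by positivity)]
    calc X * L ^ (P - 1) ≤ X * X ^ (P - 1) := by gcongr
      _ = X ^ P := by
          rw [Real.rpow_sub_one hXpos.ne', mul_div_cancel₀ _ hXpos.ne']

lemma rpow_pow_mul_rootProximity_le {p : ℂ[X]} {n m : ℕ} (hm : p.natDegree ≤ m) {s q β : ℝ}
    (hs : 0 ≤ s) (hq : 0 < q) (hβ : 0 < β) (h : s * (n / q + m / β) ≤ 1) (t : ℝ) :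
    ((1 + |t|) ^ n * rootProximity p t) ^ s ≤
      (1 + |t|) ^ q + ∑ a ∈ p.roots.toFinset, (1 + 1 / ‖(t : ℂ) - a‖) ^ β := by
  set X := (1 + |t|) ^ q + ∑ a ∈ p.roots.toFinset, (1 + 1 / ‖(t : ℂ) - a‖) ^ β with hX
  have hsum : 0 ≤ ∑ a ∈ p.roots.toFinset, (1 + 1 / ‖(t : ℂ) - a‖) ^ β :=
    Finset.sum_nonneg fun a _ => by positivity
  have hone : 1 ≤ (1 + |t|) ^ q := Real.one_le_rpow (by linarith [abs_nonneg t]) hq.le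
  have hX1 : 1 ≤ X := by linarith
  have hX0 : 0 < X := by linarith
  have hle {r b : ℝ} (hr : 0 < r) (hb : 0 ≤ b) (hbX : b ^ r ≤ X) : b ≤ X ^ (1 / r) := by
    rwa [one_div, Real.le_rpow_inv_iff_of_pos hb hX0.le hr]
  have hprod : rootProximity p t ≤ (X ^ (1 / β)) ^ m := by
    calc rootProximity p t ≤ (p.roots.map fun _ => X ^ (1 / β)).prod := by
          refine Multiset.prod_map_le_prod_map₀ _ _ (fun a _ => by positivity) fun a ha => ?_
          have hterm := Finset.single_le_sum (f := fun a => (1 + 1 / ‖(t : ℂ) - a‖) ^ β)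
            (fun a _ => by positivity) (Multiset.mem_toFinset.2 ha)
          exact hle hβ (by positivity) (by linarith)
      _ = (X ^ (1 / β)) ^ p.natDegree := prod_map_roots_const p _
      _ ≤ (X ^ (1 / β)) ^ m := pow_le_pow_right₀ (Real.one_le_rpow hX1 (by positivity)) hm
  have hprox := rootProximity_nonneg p t
  calc ((1 + |t|) ^ n * rootProximity p t) ^ s
      ≤ ((X ^ (1 / q)) ^ n * (X ^ (1 / β)) ^ m) ^ s := by
        gcongr
        exact hle hq (by positivity) (by linarith)
    _ = X ^ (s * (n / q + m / β)) := by
        rw [← Real.rpow_natCast, ← Real.rpow_natCast, ← Real.rpow_mul hX0.le,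
          ← Real.rpow_mul hX0.le, ← Real.rpow_add hX0, ← Real.rpow_mul hX0.le]
        congr 1
        ring
    _ ≤ X ^ (1 : ℝ) := Real.rpow_le_rpow_of_exponent_le hX1 h
    _ = X := Real.rpow_one X

lemma exists_exponents {x y s q α : ℝ} (hx : 0 ≤ x) (hy : 0 ≤ y) (hs : 0 ≤ s) (hq : 0 < q)
    (hα : 0 < α) (h : s * (x / q + y / α) < 1) :
    ∃ P β : ℝ, 1 < P ∧ 0 < β ∧ β < α ∧ s * P * (x / q + y / β) ≤ 1 := by
  set τ := s * (x / q + y / α) with hτ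
  have hτ0 : 0 ≤ τ := by positivity
  have hlt : 1 < 2 / (1 + τ) := by
    rw [lt_div_iff₀ (by linarith)]
    linarith
  set P := Real.sqrt (2 / (1 + τ)) with hP
  have hP1 : 1 < P := by
    rw [hP]
    exact Real.lt_sqrt_of_sq_lt (by linarith)
  have hPP : P * P = 2 / (1 + τ) := Real.mul_self_sqrt (by linarith)
  refine ⟨P, α / P, hP1, by positivity, div_lt_self hα hP1, ?_⟩
  have hxq : 0 ≤ x / q := by positivity
  calc s * P * (x / q + y / (α / P)) = s * P * (x / q + P * (y / α)) := by
        congr 2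
        field_simp
    _ ≤ s * P * (P * (x / q) + P * (y / α)) := by
        gcongr
        nlinarith
    _ = (P * P) * τ := by
        rw [hτ]
        ring
    _ ≤ 1 := by
        rw [hPP, div_mul_eq_mul_div, div_le_one (by linarith)]
        linarith

lemma lintegral_one_add_rpow_add_sum_le {μ : Measure ℝ} {q β M₁ M₂ : ℝ} {m : ℕ} (hM₁ : 0 ≤ M₁)
    (hM₂ : 0 ≤ M₂) (h₁ : ∫⁻ t, ENNReal.ofReal ((1 + |t|) ^ q) ∂μ ≤ ENNReal.ofReal M₁)
    (h₂ : ∀ b : ℂ, ∫⁻ t : ℝ, ENNReal.ofReal ((1 + 1 / ‖(t : ℂ) - b‖) ^ β) ∂μ ≤ ENNReal.ofReal M₂)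
    (F : Finset ℂ) (hF : F.card ≤ m) :
    ∫⁻ t : ℝ, ENNReal.ofReal ((1 + |t|) ^ q + ∑ a ∈ F, (1 + 1 / ‖(t : ℂ) - a‖) ^ β) ∂μ ≤
      ENNReal.ofReal (M₁ + m * M₂) := by
  have hsplit (t : ℝ) : ENNReal.ofReal ((1 + |t|) ^ q + ∑ a ∈ F, (1 + 1 / ‖(t : ℂ) - a‖) ^ β) =
      ENNReal.ofReal ((1 + |t|) ^ q) +
        ∑ a ∈ F, ENNReal.ofReal ((1 + 1 / ‖(t : ℂ) - a‖) ^ β) := by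
    rw [ENNReal.ofReal_add (by positivity) (Finset.sum_nonneg fun a _ => by positivity),
      ENNReal.ofReal_sum_of_nonneg fun a _ => by positivity]
  rw [lintegral_congr hsplit, lintegral_add_left (by fun_prop),
    lintegral_finsetSum _ fun a _ => by fun_prop]
  calc _ ≤ ENNReal.ofReal M₁ + ∑ _ ∈ F, ENNReal.ofReal M₂ :=
        add_le_add h₁ (Finset.sum_le_sum fun a _ => h₂ a)
    _ ≤ ENNReal.ofReal M₁ + m * ENNReal.ofReal M₂ := by
        rw [Finset.sum_const, nsmul_eq_mul]
        gcongr
    _ = ENNReal.ofReal (M₁ + m * M₂) := by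
        rw [← ENNReal.ofReal_natCast, ← ENNReal.ofReal_mul (by positivity),
          ← ENNReal.ofReal_add hM₁ (by positivity)]

lemma rpow_norm_eval_div_eval_le {p Q : ℂ[X]} (hp : p ≠ 0) (hQ : Q ≠ 0) {d m : ℕ}
    (hd : p.natDegree ≤ d) (hm : Q.natDegree ≤ m) {s q β P L : ℝ} (hs : 0 ≤ s) (hq : 0 < q)
    (hβ : 0 < β) (hP : 1 ≤ P) (hL : 0 < L) (h : s * P * ((d + m : ℕ) / q + m / β) ≤ 1) (t : ℝ) :
    ‖p.eval (t : ℂ) / Q.eval (t : ℂ)‖ ^ s ≤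
      (rootSize p / rootSize Q) ^ s * (L + ((1 + |t|) ^ q +
        ∑ a ∈ Q.roots.toFinset, (1 + 1 / ‖(t : ℂ) - a‖) ^ β) / L ^ (P - 1)) := by
  have hN : 0 < rootSize p / rootSize Q := div_pos (rootSize_pos hp) (rootSize_pos hQ)
  set U := (1 + |t|) ^ (d + m) * rootProximity Q t
  have hU0 : 0 ≤ U := mul_nonneg (by positivity) (rootProximity_nonneg Q t)
  calc ‖p.eval (t : ℂ) / Q.eval (t : ℂ)‖ ^ s ≤ (rootSize p / rootSize Q * U) ^ s := by
        gcongr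
        exact norm_eval_div_eval_le hQ hd hm t
    _ = (rootSize p / rootSize Q) ^ s * U ^ s := Real.mul_rpow hN.le hU0
    _ ≤ (rootSize p / rootSize Q) ^ s * (L + (U ^ s) ^ P / L ^ (P - 1)) := by
        gcongr
        exact le_add_rpow_div (by positivity) hL hP
    _ ≤ _ := by
        rw [← Real.rpow_mul hU0]
        gcongr
        exact rpow_pow_mul_rootProximity_le hm (by positivity) hq hβ h t

lemma setLIntegral_le_setLIntegral_compl {Ω : Type*} [MeasurableSpace Ω] {μ : Measure Ω}
    [IsProbabilityMeasure μ] {f Y : Ω → ℝ≥0∞} (hY : Measurable Y) {S B : Set Ω}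
    (hS : MeasurableSet S) (hB : MeasurableSet B) {a b c : ℝ≥0∞} (hle : ∀ t, f t ≤ a + b * Y t)
    (hge : ∀ t ∉ B, c ≤ f t) (hSB : μ S + μ B ≤ 1 / 2)
    (habc : a * μ S + b * ∫⁻ t, Y t ∂μ ≤ c * (1 / 2)) :
    ∫⁻ t in S, f t ∂μ ≤ ∫⁻ t in Sᶜ, f t ∂μ := by
  have hhalf : 1 / 2 ≤ μ (Sᶜ ∩ Bᶜ) := by
    rw [← Set.compl_union, prob_compl_eq_one_sub (hS.union hB)]
    calc (1 / 2 : ℝ≥0∞) = 1 - 1 / 2 := by simp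
      _ ≤ 1 - μ (S ∪ B) := tsub_le_tsub_left ((measure_union_le S B).trans hSB) 1
  calc ∫⁻ t in S, f t ∂μ ≤ ∫⁻ t in S, (a + b * Y t) ∂μ := lintegral_mono hle
    _ = a * μ S + b * ∫⁻ t in S, Y t ∂μ := by
        rw [lintegral_add_left measurable_const, lintegral_const, Measure.restrict_apply_univ,
          lintegral_const_mul _ hY]
    _ ≤ a * μ S + b * ∫⁻ t, Y t ∂μ := by
        gcongr
        exact Measure.restrict_le_self
    _ ≤ c * μ (Sᶜ ∩ Bᶜ) := habc.trans (by gcongr)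
    _ = ∫⁻ _ in Sᶜ ∩ Bᶜ, c ∂μ := by rw [lintegral_const, Measure.restrict_apply_univ]
    _ ≤ ∫⁻ t in Sᶜ ∩ Bᶜ, f t ∂μ :=
        setLIntegral_mono' (hS.compl.inter hB.compl) fun t ht => hge t ht.2
    _ ≤ ∫⁻ t in Sᶜ, f t ∂μ := lintegral_mono_set Set.inter_subset_left

lemma IsAlphaRegular.exists_measure_badPoints_le {α q C₁ C₂ : ℝ} (hα : 0 < α) (hq : 0 < q) (n : ℕ)
    {η : ℝ} (hη : 0 < η) :
    ∃ R δ : ℝ, 0 < R ∧ 0 < δ ∧ ∀ μ : Measure ℝ, IsAlphaRegular μ α C₁ → HasMomentBound μ q C₂ →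
      ∀ p : ℂ[X], p.natDegree ≤ n → μ (badPoints p R δ) ≤ ENNReal.ofReal η := by
  obtain ⟨R, hR, htail⟩ := HasMomentBound.exists_tail_le (C := C₂) hq (half_pos hη)
  obtain ⟨δ, hδ, hball⟩ := IsAlphaRegular.exists_ball_le (C := C₁) hα
    (show 0 < η / 2 / (n + 1) by positivity)
  refine ⟨R, δ, hR, hδ, fun μ hreg hmom p hp =>
    (measure_badPoints_le hp (htail μ hmom) (hball μ hreg)).trans ?_⟩
  rw [← ENNReal.ofReal_natCast, ← ENNReal.ofReal_mul (by positivity),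
    ← ENNReal.ofReal_add (by positivity) (by positivity)]
  refine ENNReal.ofReal_le_ofReal ?_
  have hn : n * (η / 2 / (n + 1)) ≤ η / 2 := by
    rw [mul_div_left_comm]
    exact mul_le_of_le_one_right (by positivity) ((div_le_one (by positivity)).2 (by linarith))
  linarith

lemma setLIntegral_norm_eval_div_eval_le_compl {μ : Measure ℝ} [IsProbabilityMeasure μ] {p Q : ℂ[X]}
    (hp : p ≠ 0) (hQ : Q ≠ 0) {d m : ℕ} (hd : p.natDegree ≤ d) (hm : Q.natDegree ≤ m)
    {s q β P R δ M L c : ℝ} (hs : 0 ≤ s) (hq : 0 < q) (hβ : 0 < β) (hP : 1 ≤ P) (hR : 0 ≤ R)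
    (hδ : 0 < δ) (hM : 0 < M) (hL : 0 < L) (h : s * P * ((d + m : ℕ) / q + m / β) ≤ 1)
    (hc : c = (1 / ((1 + R) ^ (d + m) * (1 + 1 / δ) ^ d)) ^ s) (hLP : L ^ (P - 1) = 4 * M / c)
    (hmom : ∫⁻ t : ℝ, ENNReal.ofReal
      ((1 + |t|) ^ q + ∑ a ∈ Q.roots.toFinset, (1 + 1 / ‖(t : ℂ) - a‖) ^ β) ∂μ ≤ ENNReal.ofReal M)
    (hbad : μ (badPoints (p * Q) R δ) ≤ ENNReal.ofReal (1 / 4)) {S : Set ℝ} (hS : MeasurableSet S)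
    (hμS : μ S ≤ ENNReal.ofReal (min (1 / 4) (c / (4 * L)))) :
    ∫⁻ t in S, ENNReal.ofReal (‖p.eval (t : ℂ) / Q.eval (t : ℂ)‖ ^ s) ∂μ ≤
      ∫⁻ t in Sᶜ, ENNReal.ofReal (‖p.eval (t : ℂ) / Q.eval (t : ℂ)‖ ^ s) ∂μ := by
  have hcpos : 0 < c := hc ▸ by positivity
  have hhalf : ENNReal.ofReal (1 / 2) = 1 / 2 := by simp
  have hN : 0 < rootSize p / rootSize Q := div_pos (rootSize_pos hp) (rootSize_pos hQ)
  set N := rootSize p / rootSize Q with hN_def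
  set Y : ℝ → ℝ := fun t => (1 + |t|) ^ q + ∑ a ∈ Q.roots.toFinset, (1 + 1 / ‖(t : ℂ) - a‖) ^ β
    with hY
  have hY0 (t : ℝ) : 0 ≤ Y t :=
    add_nonneg (by positivity) (Finset.sum_nonneg fun a _ => by positivity)
  refine setLIntegral_le_setLIntegral_compl (Y := fun t => ENNReal.ofReal (Y t))
    (a := ENNReal.ofReal (N ^ s * L)) (b := ENNReal.ofReal (N ^ s * (c / (4 * M))))
    (c := ENNReal.ofReal (N ^ s * c)) (by fun_prop) hS (measurableSet_badPoints (p * Q) R δ)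
    (fun t => ?_) (fun t ht => ?_) ?_ ?_
  · rw [← ENNReal.ofReal_mul (by positivity),
      ← ENNReal.ofReal_add (by positivity) (mul_nonneg (by positivity) (hY0 t))]
    refine ENNReal.ofReal_le_ofReal
      ((rpow_norm_eval_div_eval_le hp hQ hd hm hs hq hβ hP hL h t).trans_eq ?_)
    rw [hLP, hY, hN_def]
    field_simp
  · refine ENNReal.ofReal_le_ofReal ?_
    rw [hc, ← Real.mul_rpow hN.le (by positivity), mul_one_div]
    gcongr
    exact (div_le_iff₀ (by positivity)).2 (rootSize_div_rootSize_le hp hQ hd hm hδ ht)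
  · refine (add_le_add (hμS.trans (ENNReal.ofReal_le_ofReal (min_le_left _ _))) hbad).trans_eq ?_
    rw [← ENNReal.ofReal_add (by norm_num) (by norm_num), ← hhalf]
    norm_num
  · calc _ ≤ ENNReal.ofReal (N ^ s * L) * ENNReal.ofReal (c / (4 * L)) +
          ENNReal.ofReal (N ^ s * (c / (4 * M))) * ENNReal.ofReal M := by
          gcongr
          exact hμS.trans (ENNReal.ofReal_le_ofReal (min_le_right _ _))
      _ = ENNReal.ofReal (N ^ s * c * (1 / 2)) := by
          rw [← ENNReal.ofReal_mul (by positivity), ← ENNReal.ofReal_mul (by positivity),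
            ← ENNReal.ofReal_add (by positivity) (by positivity)]
          congr 1
          field_simp
          norm_num
      _ = ENNReal.ofReal (N ^ s * c) * (1 / 2) := by
          rw [ENNReal.ofReal_mul (by positivity), hhalf]

theorem exists_rational_decoupling {α q s C₁ C₂ : ℝ} (hα : 0 < α) (hq : 0 < q) (hs : 0 < s)
    (d m : ℕ) (h : s * (((d + m : ℕ) : ℝ) / q + m / α) < 1) :
    ∃ η : ℝ, 0 < η ∧ ∀ μ : Measure ℝ, IsProbabilityMeasure μ → IsAlphaRegular μ α C₁ →
      HasMomentBound μ q C₂ → ∀ S : Set ℝ, MeasurableSet S → μ S ≤ ENNReal.ofReal η →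
      ∀ p Q : ℂ[X], p.natDegree ≤ d → Q.natDegree ≤ m → Q ≠ 0 →
        ∫⁻ t in S, ENNReal.ofReal (‖p.eval (t : ℂ) / Q.eval (t : ℂ)‖ ^ s) ∂μ ≤
          ∫⁻ t in Sᶜ, ENNReal.ofReal (‖p.eval (t : ℂ) / Q.eval (t : ℂ)‖ ^ s) ∂μ := by
  obtain ⟨P, β, hP, hβ, hβα, hPβ⟩ := exists_exponents (Nat.cast_nonneg _) (Nat.cast_nonneg _)
    hs.le hq hα h
  obtain ⟨M₁, hM₁, hmom⟩ := HasMomentBound.exists_lintegral_one_add_le (C := C₂) hq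
  obtain ⟨M₂, hM₂, hinv⟩ := IsAlphaRegular.exists_lintegral_inv_le (C := C₁) hβ hβα
  obtain ⟨R, δ, hR, hδ, hbad⟩ := IsAlphaRegular.exists_measure_badPoints_le (C₁ := C₁) (C₂ := C₂)
    hα hq (d + m) (show (0 : ℝ) < 1 / 4 by norm_num)
  have hc : 0 < (1 / ((1 + R) ^ (d + m) * (1 + 1 / δ) ^ d)) ^ s := by positivity
  set c := (1 / ((1 + R) ^ (d + m) * (1 + 1 / δ) ^ d)) ^ s with hc_def
  have hM : 0 < M₁ + m * M₂ + 1 := by positivity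
  set M := M₁ + m * M₂ + 1
  obtain ⟨L, hL, hLP⟩ : ∃ L : ℝ, 0 < L ∧ L ^ (P - 1) = 4 * M / c :=
    ⟨(4 * M / c) ^ (P - 1)⁻¹, by positivity,
      Real.rpow_inv_rpow (by positivity) (sub_pos.2 hP).ne'⟩
  refine ⟨min (1 / 4) (c / (4 * L)), by positivity, ?_⟩
  intro μ hμ hreg hmb S hS hμS p Q hp hQ hQ0
  rcases eq_or_ne p 0 with rfl | hp0
  · simp [Real.zero_rpow hs.ne']
  refine setLIntegral_norm_eval_div_eval_le_compl hp0 hQ0 hp hQ hs.le hq hβ hP.le hR.le hδ hM hL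
    hPβ hc_def hLP ?_ (hbad μ hreg hmb _ (natDegree_mul_le.trans (add_le_add hp hQ))) hS hμS
  exact (lintegral_one_add_rpow_add_sum_le hM₁ hM₂ (hmom μ hμ hmb) (hinv μ hμ hreg) _
    ((Multiset.toFinset_card_le _).trans ((card_roots' Q).trans hQ))).trans
    (ENNReal.ofReal_le_ofReal (by linarith))

end Decoupling

section MatrixNorm

variable {k : ℕ}

lemma norm_entry_le (M : Mat k) (i j : Fin k) : ‖M i j‖ ≤ ‖M‖ := by
  have hcol : (Matrix.toEuclideanLin M (EuclideanSpace.single j 1)) i = M i j := by simp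
  rw [← hcol]
  refine (PiLp.norm_apply_le _ i).trans ((norm_toEuclideanLin_le M _).trans ?_)
  simp

lemma norm_fib_le_sum (u : Fib k) : ‖u‖ ≤ ∑ i, ‖u i‖ := by
  have hsum := (EuclideanSpace.basisFun (Fin k) ℂ).sum_repr u
  calc ‖u‖ = ‖∑ i, (EuclideanSpace.basisFun (Fin k) ℂ).repr u i •
        EuclideanSpace.basisFun (Fin k) ℂ i‖ := by rw [hsum]
    _ ≤ ∑ i, ‖u i‖ := by
        refine (norm_sum_le _ _).trans_eq (Finset.sum_congr rfl fun i _ => ?_)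
        rw [norm_smul]
        simp

lemma norm_le_sum_entries (M : Mat k) : ‖M‖ ≤ ∑ i, ∑ j, ‖M i j‖ := by
  rw [Matrix.l2_opNorm_def]
  refine ContinuousLinearMap.opNorm_le_bound _ (by positivity) fun u => ?_
  refine (norm_fib_le_sum _).trans ?_
  rw [Finset.sum_mul]
  refine Finset.sum_le_sum fun i _ => ?_
  calc ‖(Matrix.toEuclideanLin M u) i‖ = ‖∑ j, M i j * u j‖ := by
        simp [Matrix.mulVec, dotProduct]
    _ ≤ ∑ j, ‖M i j‖ * ‖u‖ := by
        refine (norm_sum_le _ _).trans (Finset.sum_le_sum fun j _ => ?_)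
        rw [norm_mul]
        gcongr
        exact PiLp.norm_apply_le u j
    _ = (∑ j, ‖M i j‖) * ‖u‖ := (Finset.sum_mul ..).symm

lemma norm_smul_one_le (z : ℂ) : ‖z • (1 : Mat k)‖ ≤ ‖z‖ := by
  rw [Matrix.l2_opNorm_def]
  refine ContinuousLinearMap.opNorm_le_bound _ (norm_nonneg z) fun u => ?_
  simp [norm_smul]

lemma exists_pos_norm_le_of_continuous {E F : Type*} [NormedAddCommGroup E] [ProperSpace E]
    [NormedAddCommGroup F] {f : E → F} (hf : Continuous f) (r : ℝ) :
    ∃ D : ℝ, 0 < D ∧ ∀ x, ‖x‖ ≤ r → ‖f x‖ ≤ D := by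
  obtain ⟨D, hD⟩ := (isCompact_closedBall (0 : E) r).exists_bound_of_continuousOn hf.continuousOn
  exact ⟨max D 1, by positivity, fun x hx =>
    (hD x (mem_closedBall_zero_iff.2 hx)).trans (le_max_left _ _)⟩

lemma norm_det_mul_norm_le (M X : Mat k) : ‖M.det‖ * ‖X‖ ≤ ‖M.adjugate‖ * ‖M * X‖ := by
  calc ‖M.det‖ * ‖X‖ = ‖M.adjugate * (M * X)‖ := by
        rw [← norm_smul, ← mul_assoc, Matrix.adjugate_mul, smul_mul_assoc, one_mul]
    _ ≤ ‖M.adjugate‖ * ‖M * X‖ := norm_mul_le _ _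

end MatrixNorm

section SingleSite

lemma ofReal_sum_rpow_le {ι : Type*} (F : Finset ι) {a : ι → ℝ} (ha : ∀ i, 0 ≤ a i) {s : ℝ}
    (hs : 0 < s) (hs1 : s ≤ 1) :
    ENNReal.ofReal ((∑ i ∈ F, a i) ^ s) ≤ ∑ i ∈ F, ENNReal.ofReal (a i ^ s) := by
  classical
  induction F using Finset.induction_on with
  | empty => simp [Real.zero_rpow hs.ne']
  | insert i F hi ih =>
    rw [Finset.sum_insert hi, Finset.sum_insert hi]
    have hsum : 0 ≤ ∑ i ∈ F, a i := Finset.sum_nonneg fun i _ => ha i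
    refine (ENNReal.ofReal_le_ofReal (Real.rpow_add_le_add_rpow (ha i) hsum hs.le hs1)).trans ?_
    rw [ENNReal.ofReal_add (Real.rpow_nonneg (ha i) _) (by positivity)]
    gcongr

variable {k : ℕ}

lemma ofReal_norm_rpow_le_sum_entries (M : Mat k) {s : ℝ} (hs : 0 < s) (hs1 : s ≤ 1) :
    ENNReal.ofReal (‖M‖ ^ s) ≤ ∑ i, ∑ j, ENNReal.ofReal (‖M i j‖ ^ s) :=
  calc ENNReal.ofReal (‖M‖ ^ s) ≤ ENNReal.ofReal ((∑ i, ∑ j, ‖M i j‖) ^ s) := by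
        gcongr
        exact norm_le_sum_entries M
    _ ≤ ∑ i, ENNReal.ofReal ((∑ j, ‖M i j‖) ^ s) :=
        ofReal_sum_rpow_le _ (fun i => by positivity) hs hs1
    _ ≤ ∑ i, ∑ j, ENNReal.ofReal (‖M i j‖ ^ s) :=
        Finset.sum_le_sum fun i _ => ofReal_sum_rpow_le _ (fun j => norm_nonneg _) hs hs1

lemma pow_le_norm_det_scalar_sub (E : Mat k) {R δ t : ℝ} (hδ : 0 ≤ δ)
    (ht : t ∉ badPoints E.charpoly R δ) :
    δ ^ k ≤ ‖(Matrix.scalar (Fin k) (t : ℂ) - E).det‖ := by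
  rw [← Matrix.eval_charpoly, norm_eval_eq, (Matrix.charpoly_monic E).leadingCoeff, norm_one,
    one_mul]
  calc δ ^ k = (E.charpoly.roots.map fun _ => δ).prod := by
        rw [prod_map_roots_const, Matrix.charpoly_natDegree_eq_dim, Fintype.card_fin]
    _ ≤ _ := Multiset.prod_map_le_prod_map₀ _ _ (fun _ _ => hδ) fun a ha =>
        (lt_norm_sub_of_notMem_badPoints ht ha).le

lemma pow_le_norm_det_inv_mul_norm_det {A : Mat k} (hA : IsUnit A) (B : Mat k) (z : ℂ)
    {R δ t : ℝ} (hδ : 0 ≤ δ) (ht : t ∉ badPoints (A⁻¹ * (z • 1 - B)).charpoly R δ) :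
    δ ^ k ≤ ‖A⁻¹.det‖ * ‖((t : ℂ) • A + B - z • (1 : Mat k)).det‖ := by
  have hAdet : IsUnit A.det := (Matrix.isUnit_iff_isUnit_det A).1 hA
  have hfactor : A⁻¹ * ((t : ℂ) • A + B - z • (1 : Mat k)) =
      Matrix.scalar (Fin k) (t : ℂ) - A⁻¹ * (z • 1 - B) := by
    rw [add_sub_assoc, mul_add, mul_smul_comm, Matrix.nonsing_inv_mul _ hAdet, ← neg_sub (z • 1) B,
      mul_neg, ← sub_eq_add_neg, Matrix.scalar_apply, Matrix.smul_one_eq_diagonal]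
  rw [← norm_mul, ← Matrix.det_mul, hfactor]
  exact pow_le_norm_det_scalar_sub _ hδ ht

lemma norm_mul_norm_le_two_mul_norm_mul {V : Mat k} {z : ℂ} (hV : 2 * ‖V‖ ≤ ‖z‖) (X : Mat k) :
    ‖z‖ * ‖X‖ ≤ 2 * ‖(V - z • (1 : Mat k)) * X‖ := by
  have htri : ‖z‖ * ‖X‖ ≤ ‖V‖ * ‖X‖ + ‖(V - z • (1 : Mat k)) * X‖ := by
    calc ‖z‖ * ‖X‖ = ‖V * X - (V - z • (1 : Mat k)) * X‖ := by
          rw [← norm_smul, sub_mul, smul_mul_assoc, one_mul, sub_sub_cancel]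
      _ ≤ ‖V‖ * ‖X‖ + ‖(V - z • (1 : Mat k)) * X‖ :=
          (norm_sub_le _ _).trans (by gcongr; exact norm_mul_le _ _)
  nlinarith [norm_nonneg X]

/- For `|lam|` large the bounded potential is negligible against `z`; otherwise Cramer's rule
reduces the bound to a lower bound on the determinant, whose roots in `t` are the eigenvalues of
`A⁻¹ (z - B)`. -/
lemma exists_one_add_abs_mul_norm_le {b₁ b₂ R δ : ℝ} (hR : 0 ≤ R) (hδ : 0 < δ) (k : ℕ) :
    ∃ c : ℝ, 0 < c ∧ ∀ A B : Mat k, IsUnit A → ‖A‖ ≤ b₁ → ‖A⁻¹‖ ≤ b₁ → ‖B‖ ≤ b₂ →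
      ∀ (lam : ℝ) (z : ℂ), |lam| ≤ ‖z‖ → ‖z‖ ≤ |lam| + 1 →
      ∀ t ∉ badPoints (A⁻¹ * (z • 1 - B)).charpoly R δ, ∀ X : Mat k,
        (1 + |lam|) * ‖X‖ ≤ c * ‖((t : ℂ) • A + B - z • (1 : Mat k)) * X‖ := by
  set v : ℝ := R * |b₁| + |b₂|
  have hv0 : 0 ≤ v := by positivity
  obtain ⟨D, -, hadj⟩ := exists_pos_norm_le_of_continuous
    (continuous_id.matrix_adjugate : Continuous fun M : Mat k => M.adjugate) (v + (2 * v + 2))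
  obtain ⟨D', hD', hdet⟩ := exists_pos_norm_le_of_continuous
    (continuous_id.matrix_det : Continuous fun M : Mat k => M.det) b₁
  refine ⟨max 4 ((2 * v + 2) * (D' * D / δ ^ k)), by positivity, ?_⟩
  intro A B hAu hA hA' hB lam z hlam hz t ht X
  have hV : ‖(t : ℂ) • A + B‖ ≤ v := by
    refine (norm_add_le _ _).trans (add_le_add ?_ (hB.trans (le_abs_self _)))
    rw [norm_smul, Complex.norm_real, Real.norm_eq_abs]
    gcongr
    exacts [abs_le_of_notMem_badPoints ht, hA.trans (le_abs_self _)]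
  set M := (t : ℂ) • A + B - z • (1 : Mat k)
  rcases le_or_gt (2 * v + 1) |lam| with hl | hl
  · have hX := norm_mul_norm_le_two_mul_norm_mul (z := z) (by linarith : 2 * ‖_‖ ≤ ‖z‖) X
    calc (1 + |lam|) * ‖X‖ ≤ 2 * (‖z‖ * ‖X‖) := by
          rw [← mul_assoc]
          gcongr
          linarith
      _ ≤ 4 * ‖M * X‖ := by linarith
      _ ≤ _ := by
          gcongr
          exact le_max_left _ _
  · have hMadj : ‖M.adjugate‖ ≤ D :=
      hadj M ((norm_sub_le _ _).trans (add_le_add hV ((norm_smul_one_le z).trans (by linarith))))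
    have hX : δ ^ k * ‖X‖ ≤ D' * D * ‖M * X‖ := by
      calc δ ^ k * ‖X‖ ≤ ‖A⁻¹.det‖ * ‖M.det‖ * ‖X‖ := by
            gcongr
            exact pow_le_norm_det_inv_mul_norm_det hAu B z hδ.le ht
        _ ≤ ‖A⁻¹.det‖ * (‖M.adjugate‖ * ‖M * X‖) := by
            rw [mul_assoc]
            exact mul_le_mul_of_nonneg_left (norm_det_mul_norm_le M X) (norm_nonneg _)
        _ ≤ D' * D * ‖M * X‖ := by
            rw [mul_assoc]
            gcongr
            exact hdet _ hA'
    calc (1 + |lam|) * ‖X‖ ≤ (2 * v + 2) * (D' * D * ‖M * X‖ / δ ^ k) := by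
          refine mul_le_mul (by linarith) ?_ (norm_nonneg X) (by positivity)
          rwa [le_div_iff₀' (by positivity)]
      _ = (2 * v + 2) * (D' * D / δ ^ k) * ‖M * X‖ := by ring
      _ ≤ _ := by
          gcongr
          exact le_max_right _ _

lemma exists_expanding {α q C₁ C₂ b₁ b₂ : ℝ} (hα : 0 < α) (hq : 0 < q) (k : ℕ) {η : ℝ}
    (hη : 0 < η) :
    ∃ c : ℝ, 0 < c ∧ ∀ μ : Measure ℝ, IsAlphaRegular μ α C₁ → HasMomentBound μ q C₂ →
      ∀ A B : Mat k, IsUnit A → ‖A‖ ≤ b₁ → ‖A⁻¹‖ ≤ b₁ → ‖B‖ ≤ b₂ →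
      ∀ lam ε : ℝ, 0 < ε → ε ≤ 1 → ∃ S : Set ℝ, MeasurableSet S ∧ μ S ≤ ENNReal.ofReal η ∧
        ∀ t ∉ S, ∀ X : Mat k, (1 + |lam|) * ‖X‖ ≤
          c * ‖((t : ℂ) • A + B - ((lam : ℂ) + ε * Complex.I) • (1 : Mat k)) * X‖ := by
  obtain ⟨R, δ, hR, hδ, hbad⟩ := IsAlphaRegular.exists_measure_badPoints_le (C₁ := C₁) (C₂ := C₂)
    hα hq k hη
  obtain ⟨c, hc, hexp⟩ := exists_one_add_abs_mul_norm_le (b₁ := b₁) (b₂ := b₂) hR.le hδ k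
  refine ⟨c, hc, fun μ hreg hmb A B hAu hA hA' hB lam ε hε hε1 => ?_⟩
  set z : ℂ := (lam : ℂ) + ε * Complex.I with hz
  have hlam : |lam| ≤ ‖z‖ := by simpa [hz] using Complex.abs_re_le_norm z
  have hz_le : ‖z‖ ≤ |lam| + 1 := by
    refine (norm_add_le _ _).trans ?_
    rw [norm_mul, Complex.norm_real, Complex.norm_real, Complex.norm_I, mul_one,
      Real.norm_eq_abs, Real.norm_eq_abs, abs_of_pos hε]
    linarith
  refine ⟨badPoints (A⁻¹ * (z • 1 - B)).charpoly R δ, measurableSet_badPoints _ R δ,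
    hbad μ hreg hmb _ ?_, hexp A B hAu hA hA' hB lam z hlam hz_le⟩
  rw [Matrix.charpoly_natDegree_eq_dim, Fintype.card_fin]

lemma lintegral_norm_rpow_le_of_entries {Ω : Type*} [MeasurableSpace Ω] {μ : Measure Ω} {s : ℝ}
    (hs : 0 < s) (hs1 : s ≤ 1) {X : Ω → Mat k}
    (hX : ∀ i j, Measurable fun t => ENNReal.ofReal (‖X t i j‖ ^ s)) {J : ℝ≥0∞}
    (hJ : ∀ i j, ∫⁻ t, ENNReal.ofReal (‖X t i j‖ ^ s) ∂μ ≤ J) :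
    ∫⁻ t, ENNReal.ofReal (‖X t‖ ^ s) ∂μ ≤ k * (k * J) := by
  calc ∫⁻ t, ENNReal.ofReal (‖X t‖ ^ s) ∂μ
      ≤ ∫⁻ t, ∑ i, ∑ j, ENNReal.ofReal (‖X t i j‖ ^ s) ∂μ := by
        exact lintegral_mono fun t => ofReal_norm_rpow_le_sum_entries (X t) hs hs1
    _ = ∑ i, ∑ j, ∫⁻ t, ENNReal.ofReal (‖X t i j‖ ^ s) ∂μ := by
        rw [lintegral_finsetSum _ fun i _ => Finset.measurable_sum _ fun j _ => hX i j]
        exact Finset.sum_congr rfl fun i _ => lintegral_finsetSum _ fun j _ => hX i j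
    _ ≤ ∑ _ : Fin k, ∑ _ : Fin k, J :=
        Finset.sum_le_sum fun i _ => Finset.sum_le_sum fun j _ => hJ i j
    _ = k * (k * J) := by
        simp only [Finset.sum_const, Finset.card_univ, Fintype.card_fin, nsmul_eq_mul]

lemma lintegral_norm_rpow_le_setLIntegral_compl {Ω : Type*} [MeasurableSpace Ω] {μ : Measure Ω}
    {s : ℝ} (hs : 0 < s) (hs1 : s ≤ 1) {X : Ω → Mat k}
    (hX : ∀ i j, Measurable fun t => ENNReal.ofReal (‖X t i j‖ ^ s)) {S : Set Ω}
    (hS : MeasurableSet S)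
    (hdec : ∀ i j, ∫⁻ t in S, ENNReal.ofReal (‖X t i j‖ ^ s) ∂μ ≤
      ∫⁻ t in Sᶜ, ENNReal.ofReal (‖X t i j‖ ^ s) ∂μ) :
    ∫⁻ t, ENNReal.ofReal (‖X t‖ ^ s) ∂μ ≤
      k * (k * (2 * ∫⁻ t in Sᶜ, ENNReal.ofReal (‖X t‖ ^ s) ∂μ)) := by
  refine lintegral_norm_rpow_le_of_entries hs hs1 hX fun i j => ?_
  have hentry : ∫⁻ t in Sᶜ, ENNReal.ofReal (‖X t i j‖ ^ s) ∂μ ≤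
      ∫⁻ t in Sᶜ, ENNReal.ofReal (‖X t‖ ^ s) ∂μ :=
    lintegral_mono fun t => ENNReal.ofReal_le_ofReal
      (Real.rpow_le_rpow (norm_nonneg _) (norm_entry_le _ i j) hs.le)
  rw [← lintegral_add_compl _ hS, two_mul]
  exact add_le_add ((hdec i j).trans hentry) hentry

/-- The decoupling inequality, with constant `a`, for the random single-site potential `t A + B`
with `t` distributed according to `μ`: the factor `t A + B - z` can be inserted into the fractional
moment of any solution `X` of a linear pencil equation `(1 + t N) X(t) = F`. As a function of the
potential at `x`, every matrix element `G_z(x, y)` of the resolvent is such a solution. -/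
def SiteDecoupling (μ : Measure ℝ) (A B : Mat k) (s a : ℝ) (z : ℂ) : Prop :=
  ∀ (N F : Mat k) (X : ℝ → Mat k),
    (∀ t : ℝ, (1 + (t : ℂ) • N).det ≠ 0) → (∀ t : ℝ, (1 + (t : ℂ) • N) * X t = F) →
    fracMoment μ s X ≤
      ENNReal.ofReal a * fracMoment μ s fun t => ((t : ℂ) • A + B - z • (1 : Mat k)) * X t

lemma SiteDecoupling.mono {μ : Measure ℝ} {A B : Mat k} {s a a' : ℝ} {z : ℂ}
    (h : SiteDecoupling μ A B s a z) (haa' : a ≤ a') : SiteDecoupling μ A B s a' z :=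
  fun N F X hdet hX => (h N F X hdet hX).trans (by gcongr)

lemma setLIntegral_compl_le_of_expanding {μ : Measure ℝ} {s c l : ℝ} (hs : 0 < s) (hc : 0 ≤ c)
    (hl : 0 < l) {S : Set ℝ} (hS : MeasurableSet S) {X Y : ℝ → Mat k}
    (h : ∀ t ∉ S, l * ‖X t‖ ≤ c * ‖Y t‖) :
    ∫⁻ t in Sᶜ, ENNReal.ofReal (‖X t‖ ^ s) ∂μ ≤
      ENNReal.ofReal (c ^ s / l ^ s) * fracMoment μ s Y := by
  rw [fracMoment, ← lintegral_const_mul' _ _ ENNReal.ofReal_ne_top]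
  refine (setLIntegral_mono' hS.compl fun t ht => ?_).trans (setLIntegral_le_lintegral _ _)
  rw [← Real.div_rpow hc hl.le, ← ENNReal.ofReal_mul (by positivity),
    ← Real.mul_rpow (by positivity) (norm_nonneg _)]
  refine ENNReal.ofReal_le_ofReal (Real.rpow_le_rpow (norm_nonneg _) ?_ hs.le)
  rw [div_mul_eq_mul_div, le_div_iff₀' hl]
  exact h t ht

theorem exists_siteDecoupling_of_dim {α q s C₁ C₂ b₁ b₂ : ℝ} (hα : 0 < α) (hq : 0 < q)
    (hs : 0 < s) (n : ℕ) (h : s * (((n + (n + 1) : ℕ) : ℝ) / q + ((n + 1 : ℕ) : ℝ) / α) < 1) :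
    ∃ c : ℝ, 0 < c ∧ ∀ μ : Measure ℝ, IsProbabilityMeasure μ → IsAlphaRegular μ α C₁ →
      HasMomentBound μ q C₂ → ∀ A B : Mat (n + 1), IsUnit A → ‖A‖ ≤ b₁ → ‖A⁻¹‖ ≤ b₁ → ‖B‖ ≤ b₂ →
      ∀ lam ε : ℝ, 0 < ε → ε ≤ 1 →
        SiteDecoupling μ A B s (c / (1 + |lam|) ^ s) (lam + ε * Complex.I) := by
  obtain ⟨η, hη, hdec⟩ := exists_rational_decoupling (C₁ := C₁) (C₂ := C₂) hα hq hs n (n + 1) h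
  obtain ⟨c, hc, hexp⟩ := exists_expanding (C₁ := C₁) (C₂ := C₂) (b₁ := b₁) (b₂ := b₂) hα hq
    (n + 1) hη
  refine ⟨(n + 1 : ℕ) * ((n + 1 : ℕ) * (2 * c ^ s)), by positivity, ?_⟩
  intro μ hμ hreg hmb A B hAu hA hA' hB lam ε hε hε1 N F X hdet hX
  have hs1 : s ≤ 1 := by
    have hsα : s * (1 / α) ≤ s * (((n + (n + 1) : ℕ) : ℝ) / q + ((n + 1 : ℕ) : ℝ) / α) := by
      gcongr
      exact le_add_of_nonneg_of_le (by positivity) (by gcongr; simp)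
    rw [mul_one_div] at hsα
    exact ((div_le_one hα).1 (hsα.trans h.le)).trans hreg.exponent_le_one
  obtain ⟨S, hS, hμS, hSX⟩ := hexp μ hreg hmb A B hAu hA hA' hB lam ε hε hε1
  obtain ⟨p, Q, hp, hQ, hQe, hpQ⟩ := exists_polynomial_of_linearPencil N F
  have hent (t : ℝ) (i j) : X t i j = (p i j).eval (t : ℂ) / Q.eval (t : ℂ) :=
    hpQ t (X t) (hdet t) (hX t) i j
  have hQ0 : Q ≠ 0 := by
    rintro rfl
    simpa using hQe 0
  have hmeas (i j) : Measurable fun t : ℝ => ENNReal.ofReal (‖X t i j‖ ^ s) := by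
    simp only [hent]
    fun_prop
  set J := ∫⁻ t in Sᶜ, ENNReal.ofReal (‖X t‖ ^ s) ∂μ
  set I := fracMoment μ s fun t : ℝ => ((t : ℂ) • A + B -
    ((lam : ℂ) + ε * Complex.I) • (1 : Mat (n + 1))) * X t
  have hsplit : fracMoment μ s X ≤ (n + 1 : ℕ) * ((n + 1 : ℕ) * (2 * J)) := by
    refine lintegral_norm_rpow_le_setLIntegral_compl hs hs1 hmeas hS fun i j => ?_
    simp only [hent]
    exact hdec μ hμ hreg hmb S hS hμS (p i j) Q (hp i j) hQ hQ0
  have hexpand : J ≤ ENNReal.ofReal (c ^ s / (1 + |lam|) ^ s) * I :=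
    setLIntegral_compl_le_of_expanding hs hc.le (by positivity) hS fun t ht => hSX t ht (X t)
  calc fracMoment μ s X ≤ (n + 1 : ℕ) * ((n + 1 : ℕ) *
        (2 * (ENNReal.ofReal (c ^ s / (1 + |lam|) ^ s) * I))) := hsplit.trans (by gcongr)
    _ = ENNReal.ofReal ((n + 1 : ℕ) * ((n + 1 : ℕ) * (2 * (c ^ s / (1 + |lam|) ^ s)))) * I := by
        rw [ENNReal.ofReal_mul (by positivity), ENNReal.ofReal_mul (by positivity),
          ENNReal.ofReal_mul (by positivity), ENNReal.ofReal_natCast, ENNReal.ofReal_ofNat]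
        ring
    _ = ENNReal.ofReal ((n + 1 : ℕ) * ((n + 1 : ℕ) * (2 * c ^ s)) / (1 + |lam|) ^ s) * I := by
        rw [← mul_div_assoc, ← mul_div_assoc, ← mul_div_assoc]

lemma exponent_bounds {α q s : ℝ} (hα : 0 < α) (hq : 0 < q) (hs : 0 < s) {n : ℕ}
    (h : s ≤ α * q / (2 * (n + 1 : ℕ) * α + (n + 1 : ℕ) * q)) :
    s * (((n + (n + 1) : ℕ) : ℝ) / q + ((n + 1 : ℕ) : ℝ) / α) < 1 ∧
      n < ⌈α * q / (s * (2 * α + q))⌉₊ := by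
  have hsα : 0 < s * α := mul_pos hs hα
  push_cast at h ⊢
  rw [le_div_iff₀ (by positivity)] at h
  constructor
  · rw [div_add_div _ _ hq.ne' hα.ne', mul_div_assoc', div_lt_one (by positivity)]
    linarith
  · rw [Nat.lt_ceil, lt_div_iff₀ (by positivity)]
    linarith [mul_pos hs hq]

-- Only finitely many fibre dimensions `k` are compatible with a given `s`, so the constant can be
-- chosen independently of `k`.
theorem exists_siteDecoupling {α q s : ℝ} (C₁ C₂ b₁ b₂ : ℝ) (hα : 0 < α) (hq : 0 < q)
    (hs : 0 < s) :
    ∃ c : ℝ, 0 < c ∧ ∀ k : ℕ, 1 ≤ k → s ≤ α * q / (2 * k * α + k * q) →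
      ∀ μ : Measure ℝ, IsProbabilityMeasure μ → IsAlphaRegular μ α C₁ → HasMomentBound μ q C₂ →
      ∀ A B : Mat k, IsUnit A → ‖A‖ ≤ b₁ → ‖A⁻¹‖ ≤ b₁ → ‖B‖ ≤ b₂ →
      ∀ lam ε : ℝ, 0 < ε → ε ≤ 1 →
        SiteDecoupling μ A B s (c / (1 + |lam|) ^ s) (lam + ε * Complex.I) := by
  have hdim (n : ℕ) : ∃ c : ℝ, 0 < c ∧
      (s * (((n + (n + 1) : ℕ) : ℝ) / q + ((n + 1 : ℕ) : ℝ) / α) < 1 →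
      ∀ μ : Measure ℝ, IsProbabilityMeasure μ → IsAlphaRegular μ α C₁ → HasMomentBound μ q C₂ →
      ∀ A B : Mat (n + 1), IsUnit A → ‖A‖ ≤ b₁ → ‖A⁻¹‖ ≤ b₁ → ‖B‖ ≤ b₂ →
      ∀ lam ε : ℝ, 0 < ε → ε ≤ 1 →
        SiteDecoupling μ A B s (c / (1 + |lam|) ^ s) (lam + ε * Complex.I)) := by
    by_cases h : s * (((n + (n + 1) : ℕ) : ℝ) / q + ((n + 1 : ℕ) : ℝ) / α) < 1
    · obtain ⟨c, hc, hdec⟩ := exists_siteDecoupling_of_dim hα hq hs n h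
      exact ⟨c, hc, fun _ => hdec⟩
    · exact ⟨1, one_pos, fun h' => absurd h' h⟩
  choose c hc hdec using hdim
  set N := ⌈α * q / (s * (2 * α + q))⌉₊
  refine ⟨1 + ∑ n ∈ Finset.range N, c n,
    add_pos_of_pos_of_nonneg one_pos (Finset.sum_nonneg fun n _ => (hc n).le), ?_⟩
  intro k hk hsk μ hμ hreg hmb A B hAu hA hA' hB lam ε hε hε1
  obtain ⟨n, rfl⟩ : ∃ n, k = n + 1 := ⟨k - 1, by omega⟩
  obtain ⟨hexp, hn⟩ := exponent_bounds hα hq hs hsk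
  have hcn : c n ≤ 1 + ∑ n ∈ Finset.range N, c n :=
    (Finset.single_le_sum (fun i _ => (hc i).le) (Finset.mem_range.2 hn)).trans
      (le_add_of_nonneg_left zero_le_one)
  exact (hdec n hexp μ hμ hreg hmb A B hAu hA hA' hB lam ε hε hε1).mono (by gcongr)

end SingleSite

section Iteration

lemma le_of_forall_le_add_mul_half_pow {x y C : ℝ≥0∞} (hC : C ≠ ⊤)
    (h : ∀ n : ℕ, x ≤ y + C * (1 / 2) ^ n) : x ≤ y := by
  have hlim : Tendsto (fun n : ℕ => y + C * (1 / 2 : ℝ≥0∞) ^ n) atTop (𝓝 (y + C * 0)) := by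
    refine Tendsto.const_add y (ENNReal.Tendsto.const_mul ?_ (Or.inr hC))
    exact ENNReal.tendsto_pow_atTop_nhds_zero_of_lt_one (by simp)
  rw [mul_zero, add_zero] at hlim
  exact ge_of_tendsto' hlim h

lemma add_half_mul_two_mul_add (a b : ℝ≥0∞) : a + 1 / 2 * (2 * a + b) = 2 * a + 1 / 2 * b := by
  rw [mul_add, ← mul_assoc, ENNReal.div_mul_cancel (by simp) (by simp)]
  ring

variable {V : Type u} {G : SimpleGraph V} [G.LocallyFinite] {κ : ℕ} {m : V → ℝ≥0∞} {y : V}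
  {a ρ B : ℝ≥0∞}

lemma sum_neighbor_le (hdeg : ∀ x, G.degree x ≤ κ) {b : ℝ≥0∞} (x : V)
    (h : ∀ u, G.Adj x u → m u ≤ b) : ρ * ∑ u ∈ G.neighborFinset x, m u ≤ κ * ρ * b := by
  calc ρ * ∑ u ∈ G.neighborFinset x, m u ≤ ρ * ∑ _u ∈ G.neighborFinset x, b := by
        gcongr with u hu
        exact h u ((SimpleGraph.mem_neighborFinset _ _ _).1 hu)
    _ ≤ ρ * (κ * b) := by
        rw [Finset.sum_const, nsmul_eq_mul, SimpleGraph.card_neighborFinset_eq_degree]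
        gcongr
        exact hdeg x
    _ = κ * ρ * b := by ring

lemma tsum_sum_neighbor_le (hdeg : ∀ x, G.degree x ≤ κ) (b : V → ℝ≥0∞) :
    ∑' x, ∑ u ∈ G.neighborFinset x, b u ≤ κ * ∑' x, b x := by
  classical
  have hsum (x : V) (f : V → ℝ≥0∞) :
      ∑' u, (if G.Adj x u then f u else 0) = ∑ u ∈ G.neighborFinset x, f u := by
    rw [tsum_eq_sum (s := G.neighborFinset x) fun u hu =>
      if_neg (mt (SimpleGraph.mem_neighborFinset _ _ _).2 hu)]
    exact Finset.sum_congr rfl fun u hu => if_pos ((SimpleGraph.mem_neighborFinset _ _ _).1 hu)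
  calc ∑' x, ∑ u ∈ G.neighborFinset x, b u = ∑' u, ∑' x, if G.Adj u x then b u else 0 := by
        simp_rw [← hsum]
        rw [ENNReal.tsum_comm]
        simp_rw [G.adj_comm]
    _ ≤ ∑' u, κ * b u := by
        refine ENNReal.tsum_le_tsum fun u => ?_
        rw [hsum u fun _ => b u, Finset.sum_const, nsmul_eq_mul,
          SimpleGraph.card_neighborFinset_eq_degree]
        gcongr
        exact hdeg u
    _ = κ * ∑' x, b x := ENNReal.tsum_mul_left

open Classical in
/-- A subsolution `m` of the equation `m = a δ_y + ρ ∑_{u ∼ ·} m u` on the graph `G`. Fractional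
moments of the Green function are subsolutions in their first argument. -/
def IsSubsolution (G : SimpleGraph V) [G.LocallyFinite] (y : V) (a ρ : ℝ≥0∞) (m : V → ℝ≥0∞) :
    Prop :=
  ∀ x, m x ≤ a * (if x = y then 1 else 0) + ρ * ∑ u ∈ G.neighborFinset x, m u

namespace IsSubsolution

lemma le_two_mul (hm : IsSubsolution G y a ρ m) (hdeg : ∀ x, G.degree x ≤ κ)
    (hρ : κ * ρ ≤ 1 / 2) (hB : B ≠ ⊤) (hmB : ∀ x, m x ≤ B) (x : V) : m x ≤ 2 * a := by
  refine le_of_forall_le_add_mul_half_pow hB fun n => ?_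
  induction n generalizing x with
  | zero =>
    rw [pow_zero, mul_one]
    exact le_add_left (hmB x)
  | succ n ih =>
    calc m x ≤ a * 1 + κ * ρ * (2 * a + B * (1 / 2) ^ n) :=
          (hm x).trans (add_le_add (by gcongr; split_ifs <;> simp)
            (sum_neighbor_le hdeg x fun u _ => ih u))
      _ ≤ a + 1 / 2 * (2 * a + B * (1 / 2) ^ n) := by
          rw [mul_one]
          gcongr
      _ = 2 * a + B * (1 / 2) ^ (n + 1) := by
          rw [add_half_mul_two_mul_add]
          ring

lemma le_of_le_walk_length (hm : IsSubsolution G y a ρ m) (hdeg : ∀ x, G.degree x ≤ κ)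
    (hρ : κ * ρ ≤ 1 / 2) (hB : B ≠ ⊤) (hmB : ∀ x, m x ≤ B) (n : ℕ) (x : V)
    (hn : ∀ p : G.Walk x y, n ≤ p.length) : m x ≤ 2 * a * (κ * ρ) ^ n := by
  induction n generalizing x with
  | zero =>
    rw [pow_zero, mul_one]
    exact hm.le_two_mul hdeg hρ hB hmB x
  | succ n ih =>
    have hxy : x ≠ y := by
      rintro rfl
      exact absurd (hn SimpleGraph.Walk.nil) (by simp)
    refine (hm x).trans ?_
    rw [if_neg hxy, mul_zero, zero_add]
    refine (sum_neighbor_le hdeg x fun u hu => ih u fun p => ?_).trans (le_of_eq (by ring))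
    simpa only [SimpleGraph.Walk.length_cons, Nat.add_le_add_iff_right] using
      hn (SimpleGraph.Walk.cons hu p)

open Classical in
lemma le_pow_dist (hm : IsSubsolution G y a ρ m) (hdeg : ∀ x, G.degree x ≤ κ)
    (hρ : κ * ρ ≤ 1 / 2) (hB : B ≠ ⊤) (hmB : ∀ x, m x ≤ B) (ha : a ≠ ⊤) (x : V) :
    m x ≤ 2 * a * (if G.Reachable x y then (κ * ρ) ^ G.dist x y else 0) := by
  split_ifs with h
  · exact hm.le_of_le_walk_length hdeg hρ hB hmB _ x fun p => SimpleGraph.dist_le p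
  · refine le_of_forall_le_add_mul_half_pow (C := 2 * a)
      (ENNReal.mul_ne_top (by simp) ha) fun n => ?_
    rw [mul_zero, zero_add]
    refine (hm.le_of_le_walk_length hdeg hρ hB hmB n x fun p => absurd ⟨p⟩ h).trans ?_
    gcongr

lemma exists_summable_majorant (hm : IsSubsolution G y a ρ m) (hdeg : ∀ x, G.degree x ≤ κ)
    (hρ : κ * ρ ≤ 1 / 2) (hmB : ∀ x, m x ≤ B) (n : ℕ) :
    ∃ b : V → ℝ≥0∞, ∑' x, b x ≤ 2 * a ∧ ∀ x, m x ≤ b x + B * (1 / 2) ^ n := by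
  classical
  induction n with
  | zero => exact ⟨0, by simp, fun x => by simpa using hmB x⟩
  | succ n ih =>
    obtain ⟨b, hb, hmb⟩ := ih
    refine ⟨fun x => a * (if x = y then 1 else 0) + ρ * ∑ u ∈ G.neighborFinset x, b u, ?_, ?_⟩
    · rw [ENNReal.tsum_add, ENNReal.tsum_mul_left, ENNReal.tsum_mul_left, tsum_ite_eq, mul_one]
      calc a + ρ * ∑' x, ∑ u ∈ G.neighborFinset x, b u ≤ a + ρ * (κ * (2 * a)) := by
            gcongr
            exact (tsum_sum_neighbor_le hdeg b).trans (by gcongr)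
        _ = a + κ * ρ * (2 * a + 0) := by ring
        _ ≤ a + 1 / 2 * (2 * a + 0) := by gcongr
        _ = 2 * a := by rw [add_half_mul_two_mul_add, mul_zero, add_zero]
    · intro x
      rw [add_assoc]
      refine (hm x).trans (add_le_add (by congr!) ?_)
      calc ρ * ∑ u ∈ G.neighborFinset x, m u
          ≤ ρ * ∑ u ∈ G.neighborFinset x, (b u + B * (1 / 2) ^ n) := by
            gcongr with u
            exact hmb u
        _ = ρ * ∑ u ∈ G.neighborFinset x, b u +
              ρ * ∑ u ∈ G.neighborFinset x, B * (1 / 2) ^ n := by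
            rw [Finset.sum_add_distrib, mul_add]
        _ ≤ ρ * ∑ u ∈ G.neighborFinset x, b u + 1 / 2 * (B * (1 / 2) ^ n) := by
            refine add_le_add le_rfl ?_
            exact (sum_neighbor_le (m := fun _ => B * (1 / 2) ^ n) hdeg x fun _ _ => le_rfl).trans
              (by gcongr)
        _ = ρ * ∑ u ∈ G.neighborFinset x, b u + B * (1 / 2) ^ (n + 1) := by ring

lemma tsum_le (hm : IsSubsolution G y a ρ m) (hdeg : ∀ x, G.degree x ≤ κ) (hρ : κ * ρ ≤ 1 / 2)
    (hB : B ≠ ⊤) (hmB : ∀ x, m x ≤ B) : ∑' x, m x ≤ 2 * a := by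
  rw [ENNReal.tsum_eq_iSup_sum]
  refine iSup_le fun F => le_of_forall_le_add_mul_half_pow (C := F.card * B)
    (ENNReal.mul_ne_top (by simp) hB) fun n => ?_
  obtain ⟨b, hb, hmb⟩ := hm.exists_summable_majorant hdeg hρ hmB n
  calc ∑ x ∈ F, m x ≤ ∑ x ∈ F, (b x + B * (1 / 2) ^ n) := Finset.sum_le_sum fun x _ => hmb x
    _ = ∑ x ∈ F, b x + F.card * B * (1 / 2) ^ n := by
        rw [Finset.sum_add_distrib, Finset.sum_const, nsmul_eq_mul, mul_assoc]
    _ ≤ 2 * a + F.card * B * (1 / 2) ^ n := by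
        gcongr
        exact (ENNReal.sum_le_tsum F).trans hb

end IsSubsolution

end Iteration

section Resampling

open Classical in
lemma measurable_update_prod {V : Type u} (x : V) :
    Measurable fun p : (V → ℝ) × ℝ => Function.update p.1 x p.2 := by
  rw [measurable_pi_iff]
  intro y
  rcases eq_or_ne y x with rfl | h
  · simpa only [Function.update_self] using measurable_snd
  · simp only [Function.update_of_ne h]
    fun_prop

open Classical in
lemma map_update_prod_infinitePi {V : Type u} (μ : Measure ℝ) [IsProbabilityMeasure μ] (x : V) :
    Measure.map (fun p : (V → ℝ) × ℝ => Function.update p.1 x p.2)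
      ((Measure.infinitePi fun _ : V => μ).prod μ) = Measure.infinitePi fun _ : V => μ := by
  refine Measure.eq_infinitePi _ fun F t ht => ?_
  rw [Measure.map_apply (measurable_update_prod x)
    (MeasurableSet.pi F.countable_toSet fun i _ => ht i)]
  by_cases hx : x ∈ F
  · have hpre : (fun p : (V → ℝ) × ℝ => Function.update p.1 x p.2) ⁻¹' ((F : Set V).pi t) =
        (((F.erase x : Finset V) : Set V).pi t) ×ˢ t x := by
      ext ⟨f, r⟩
      simp only [Set.mem_preimage, Set.mem_pi, Finset.mem_coe, Set.mem_prod, Finset.mem_erase]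
      constructor
      · intro h
        refine ⟨fun i hi => ?_, by simpa using h x hx⟩
        simpa [Function.update_of_ne hi.1] using h i hi.2
      · rintro ⟨h, hr⟩ i hi
        rcases eq_or_ne i x with rfl | hne
        · simpa using hr
        · simpa [Function.update_of_ne hne] using h i ⟨hne, hi⟩
    rw [hpre, Measure.prod_prod, Measure.infinitePi_pi _ fun i _ => ht i,
      Finset.prod_erase_mul F (fun i => μ (t i)) hx]
  · have hpre : (fun p : (V → ℝ) × ℝ => Function.update p.1 x p.2) ⁻¹' ((F : Set V).pi t) =
        ((F : Set V).pi t) ×ˢ Set.univ := by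
      ext ⟨f, r⟩
      simp only [Set.mem_preimage, Set.mem_pi, Finset.mem_coe, Set.mem_prod, Set.mem_univ, and_true]
      refine forall₂_congr fun i hi => ?_
      rw [Function.update_of_ne (by rintro rfl; exact hx hi)]
    rw [hpre, Measure.prod_prod, Measure.infinitePi_pi _ fun i _ => ht i, measure_univ, mul_one]

open Classical in
lemma lintegral_update_infinitePi {V : Type u} (μ : Measure ℝ) [IsProbabilityMeasure μ] (x : V)
    {F : (V → ℝ) → ℝ≥0∞} (hF : Measurable F) :
    ∫⁻ f, ∫⁻ t, F (Function.update f x t) ∂μ ∂(Measure.infinitePi fun _ : V => μ) =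
      ∫⁻ f, F f ∂(Measure.infinitePi fun _ : V => μ) := by
  have hupd := measurable_update_prod x
  conv_rhs => rw [← map_update_prod_infinitePi μ x]
  rw [lintegral_map hF hupd]
  exact (lintegral_prod _ (hF.comp hupd).aemeasurable).symm

end Resampling

section RandomGreen

variable {V : Type u} {k : ℕ} {G : SimpleGraph V} [G.LocallyFinite] {K : V → V → Mat k}
  {κ : ℕ} {b g : ℝ} {A B : V → Mat k} {z : ℂ}

lemma isHermitian_sitePotential (hA : ∀ x, (A x).IsHermitian) (hB : ∀ x, (B x).IsHermitian)
    (f : V → ℝ) (x : V) : (sitePotential A B f x).IsHermitian := by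
  refine Matrix.IsHermitian.add ?_ (hB x)
  rw [Matrix.IsHermitian, Matrix.conjTranspose_smul, (hA x).eq, Complex.star_def,
    Complex.conj_ofReal]

lemma continuous_sitePotential (x : V) : Continuous fun f : V → ℝ => sitePotential A B f x :=
  ((Complex.continuous_ofReal.comp (continuous_apply x)).smul continuous_const).add
    continuous_const

open Classical in
lemma sitePotential_update_self (f : V → ℝ) (x : V) (t : ℝ) :
    sitePotential A B (Function.update f x t) x = (t : ℂ) • A x + B x := by
  rw [sitePotential, Function.update_self]

open Classical in
lemma sitePotential_update_of_ne (f : V → ℝ) {x y : V} (h : y ≠ x) (t : ℝ) :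
    sitePotential A B (Function.update f x t) y = sitePotential A B f y := by
  rw [sitePotential, sitePotential, Function.update_of_ne h]

lemma continuous_l2_apply (x : V) (i : Fin k) : Continuous fun ψ : L2 V k => ψ x i :=
  (EuclideanSpace.proj i : Fib k →L[ℂ] ℂ).continuous.comp
    (lp.evalCLM ℂ (fun _ : V => Fib k) 2 x).continuous

open Classical in
lemma norm_apply_single_le (T : L2 V k →L[ℂ] L2 V k) (x y : V) (j : Fin k) :
    ‖T (lp.single 2 y (EuclideanSpace.single j (1 : ℂ))) x‖ ≤ ‖kernelAt T x y‖ := by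
  rw [← toEuclideanLin_kernelAt]
  refine (norm_toEuclideanLin_le _ _).trans_eq ?_
  rw [PiLp.norm_single, norm_one, mul_one]

open Classical in
lemma norm_kernelAt_entry_le (T : L2 V k →L[ℂ] L2 V k) (x y : V) (i j : Fin k) :
    ‖kernelAt T x y i j‖ ≤ ‖T (lp.single 2 y (EuclideanSpace.single j (1 : ℂ)))‖ :=
  (PiLp.norm_apply_le _ i).trans (lp.norm_apply_le_norm (by norm_num) _ x)

lemma norm_kernelAt_le (T : L2 V k →L[ℂ] L2 V k) (x y : V) : ‖kernelAt T x y‖ ≤ ‖T‖ := by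
  classical
  rw [Matrix.l2_opNorm_def]
  refine ContinuousLinearMap.opNorm_le_bound _ (norm_nonneg T) fun u => ?_
  calc ‖Matrix.toEuclideanLin (kernelAt T x y) u‖ = ‖T (lp.single 2 y u) x‖ := by
        rw [toEuclideanLin_kernelAt]
    _ ≤ ‖T (lp.single 2 y u)‖ := lp.norm_apply_le_norm (by norm_num) _ x
    _ ≤ ‖T‖ * ‖lp.single (E := fun _ : V => Fib k) 2 y u‖ := T.le_opNorm _
    _ = ‖T‖ * ‖u‖ := by rw [lp.norm_single (by norm_num)]

namespace IsBoundedHopping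

lemma norm_green_le (hK : IsBoundedHopping G K κ b) {W : V → Mat k}
    (hW : ∀ x, (W x).IsHermitian) (hz : z.im ≠ 0) (x y : V) :
    ‖green G K g W z x y‖ ≤ |z.im|⁻¹ :=
  (norm_kernelAt_le _ x y).trans (norm_resolventOp_le (hK.isSelfAdjoint_hamiltonian hW) hz)

lemma continuous_green (hK : IsBoundedHopping G K κ b) (hA : ∀ x, (A x).IsHermitian)
    (hB : ∀ x, (B x).IsHermitian) (hz : z.im ≠ 0) (x y : V) :
    Continuous fun f : V → ℝ => green G K g (sitePotential A B f) z x y := by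
  classical
  exact continuous_matrix fun i j => (continuous_l2_apply x i).comp
    (hK.continuous_resolventOp (isHermitian_sitePotential hA hB) continuous_sitePotential hz
      (lp.single 2 y (EuclideanSpace.single j (1 : ℂ))))

lemma measurable_green_rpow [Countable V] (hK : IsBoundedHopping G K κ b)
    (hA : ∀ x, (A x).IsHermitian) (hB : ∀ x, (B x).IsHermitian) (hz : z.im ≠ 0) (x y : V) (s : ℝ) :
    Measurable fun f : V → ℝ =>
      ENNReal.ofReal (‖green G K g (sitePotential A B f) z x y‖ ^ s) :=
  ((hK.continuous_green hA hB hz x y).norm.measurable.pow_const s).ennreal_ofReal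

end IsBoundedHopping

end RandomGreen

section MomentBounds

variable {V : Type u} {k : ℕ} {G : SimpleGraph V} [G.LocallyFinite] {K : V → V → Mat k}
  {κ : ℕ} {a b g s : ℝ} {A B : V → Mat k} {z : ℂ} {μ : Measure ℝ}

/-- The fractional moment of `G_z(x, y)` when the random variables `v(x)` are the coordinates of
the product probability space `(ℝ^V, μ^V)`. -/
noncomputable def greenMoment (G : SimpleGraph V) [G.LocallyFinite] (K : V → V → Mat k) (g : ℝ)
    (A B : V → Mat k) (μ : Measure ℝ) (s : ℝ) (z : ℂ) (x y : V) : ℝ≥0∞ :=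
  fracMoment (Measure.infinitePi fun _ : V => μ) s fun f => green G K g (sitePotential A B f) z x y

lemma natCast_mul_ofReal_le_half {κ : ℕ} {ρ : ℝ} (h : κ * ρ ≤ 1 / 2) :
    (κ : ℝ≥0∞) * ENNReal.ofReal ρ ≤ 1 / 2 := by
  rw [← ENNReal.ofReal_natCast, ← ENNReal.ofReal_mul (Nat.cast_nonneg κ)]
  refine (ENNReal.ofReal_le_ofReal h).trans_eq ?_
  rw [ENNReal.ofReal_div_of_pos two_pos, ENNReal.ofReal_one, ENNReal.ofReal_ofNat]

namespace IsBoundedHopping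

-- Conditionally on the other sites, `t = f x` enters `G_z(x, y)` through a rank-`k` perturbation,
-- so `t ↦ G_z(x, y)` solves a linear pencil equation and single-site decoupling applies.
open Classical in
lemma fracMoment_green_update_le (hK : IsBoundedHopping G K κ b)
    (hA : ∀ x, (A x).IsHermitian) (hB : ∀ x, (B x).IsHermitian) (hz : z.im ≠ 0) {x : V}
    (hdec : SiteDecoupling μ (A x) (B x) s a z) (f : V → ℝ) (y : V) :
    (fracMoment μ s fun t => green G K g (sitePotential A B (Function.update f x t)) z x y) ≤
      ENNReal.ofReal a * fracMoment μ s fun t =>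
        (sitePotential A B (Function.update f x t) x - z • (1 : Mat k)) *
          green G K g (sitePotential A B (Function.update f x t)) z x y := by
  have hW := isHermitian_sitePotential hA hB
  have hx (t : ℝ) : sitePotential A B (Function.update f x t) x =
      sitePotential A B (Function.update f x 0) x + (t : ℂ) • A x := by
    rw [sitePotential_update_self, sitePotential_update_self, Complex.ofReal_zero, zero_smul,
      zero_add, add_comm]
  have hne (t : ℝ) (u : V) (hu : u ≠ x) : sitePotential A B (Function.update f x t) u =
      sitePotential A B (Function.update f x 0) u := by
    rw [sitePotential_update_of_ne f hu, sitePotential_update_of_ne f hu]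
  simp only [sitePotential_update_self]
  refine hdec (green G K g (sitePotential A B (Function.update f x 0)) z x x * A x)
    (green G K g (sitePotential A B (Function.update f x 0)) z x y) _ (fun t => ?_) fun t => ?_
  · rw [← mul_smul_comm]
    exact hK.det_one_add_green_mul_ne_zero (hW _) (hW _) hz (hx t) (hne t)
  · rw [← mul_smul_comm, add_mul, one_mul]
    exact hK.green_add_green_mul_green (hW _) (hW _) hz (hx t) (hne t) y

lemma greenMoment_le_fracMoment_mul [Countable V] [IsProbabilityMeasure μ]
    (hK : IsBoundedHopping G K κ b) (hA : ∀ x, (A x).IsHermitian) (hB : ∀ x, (B x).IsHermitian)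
    (hz : z.im ≠ 0) {x : V} (hdec : SiteDecoupling μ (A x) (B x) s a z) (y : V) :
    greenMoment G K g A B μ s z x y ≤ ENNReal.ofReal a *
      fracMoment (Measure.infinitePi fun _ : V => μ) s fun f =>
        (sitePotential A B f x - z • (1 : Mat k)) * green G K g (sitePotential A B f) z x y := by
  have hpot : Continuous fun f : V → ℝ => sitePotential A B f x - z • (1 : Mat k) :=
    (continuous_sitePotential x).sub continuous_const
  have hmul : Measurable fun f : V → ℝ => ENNReal.ofReal (‖(sitePotential A B f x -
      z • (1 : Mat k)) * green G K g (sitePotential A B f) z x y‖ ^ s) :=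
    (((hpot.mul (hK.continuous_green hA hB hz x y)).norm.measurable).pow_const s).ennreal_ofReal
  rw [greenMoment, fracMoment, fracMoment,
    ← lintegral_update_infinitePi μ x (hK.measurable_green_rpow hA hB hz x y s),
    ← lintegral_update_infinitePi μ x hmul, ← lintegral_const_mul' _ _ ENNReal.ofReal_ne_top]
  exact lintegral_mono fun f => hK.fracMoment_green_update_le hA hB hz hdec f y

open Classical in
lemma norm_mul_green_le (hK : IsBoundedHopping G K κ b) {W : V → Mat k}
    (hW : ∀ x, (W x).IsHermitian) (hz : z.im ≠ 0) (hg : 0 < g) (x y : V) :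
    ‖(W x - z • (1 : Mat k)) * green G K g W z x y‖ ≤
      (if x = y then 1 else 0) + ∑ u ∈ G.neighborFinset x, |b| / g * ‖green G K g W z u y‖ := by
  rw [eq_sub_of_add_eq (hK.green_eq hW hz x y)]
  refine (norm_sub_le _ _).trans (add_le_add ?_ ?_)
  · split_ifs
    · simpa only [one_smul, norm_one] using norm_smul_one_le (k := k) 1
    · rw [norm_zero]
  · rw [norm_smul, Complex.norm_real, Real.norm_eq_abs, abs_of_pos (inv_pos.2 hg)]
    calc g⁻¹ * ‖∑ u ∈ G.neighborFinset x, K x u * green G K g W z u y‖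
        ≤ g⁻¹ * ∑ u ∈ G.neighborFinset x, |b| * ‖green G K g W z u y‖ := by
          gcongr
          refine norm_sum_le_of_le _ fun u hu => (norm_mul_le _ _).trans ?_
          gcongr
          exact (hK.norm_le x u ((SimpleGraph.mem_neighborFinset _ _ _).1 hu)).trans
            (le_abs_self b)
      _ = ∑ u ∈ G.neighborFinset x, |b| / g * ‖green G K g W z u y‖ := by
          rw [Finset.mul_sum]
          exact Finset.sum_congr rfl fun u _ => by ring

open Classical in
lemma ofReal_norm_mul_green_rpow_le (hK : IsBoundedHopping G K κ b)
    {W : V → Mat k} (hW : ∀ x, (W x).IsHermitian) (hz : z.im ≠ 0) (hs : 0 < s) (hs1 : s ≤ 1)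
    (hg : 0 < g) (x y : V) :
    ENNReal.ofReal (‖(W x - z • (1 : Mat k)) * green G K g W z x y‖ ^ s) ≤
      (if x = y then 1 else 0) + ENNReal.ofReal ((|b| / g) ^ s) *
        ∑ u ∈ G.neighborFinset x, ENNReal.ofReal (‖green G K g W z u y‖ ^ s) := by
  have hδ : (0 : ℝ) ≤ if x = y then 1 else 0 := by split_ifs <;> norm_num
  have hS : 0 ≤ ∑ u ∈ G.neighborFinset x, |b| / g * ‖green G K g W z u y‖ := by positivity
  calc ENNReal.ofReal (‖(W x - z • (1 : Mat k)) * green G K g W z x y‖ ^ s)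
      ≤ ENNReal.ofReal (((if x = y then 1 else 0) +
          ∑ u ∈ G.neighborFinset x, |b| / g * ‖green G K g W z u y‖) ^ s) := by
        gcongr
        exact hK.norm_mul_green_le hW hz hg x y
    _ ≤ ENNReal.ofReal ((if x = y then (1 : ℝ) else 0) ^ s) +
          ENNReal.ofReal ((∑ u ∈ G.neighborFinset x, |b| / g * ‖green G K g W z u y‖) ^ s) := by
        rw [← ENNReal.ofReal_add (by positivity) (by positivity)]
        exact ENNReal.ofReal_le_ofReal (Real.rpow_add_le_add_rpow hδ hS hs.le hs1)
    _ ≤ _ := by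
        refine add_le_add ?_ ?_
        · split_ifs <;> simp [Real.zero_rpow hs.ne']
        · refine (ofReal_sum_rpow_le _ (fun u => by positivity) hs hs1).trans_eq ?_
          rw [Finset.mul_sum]
          refine Finset.sum_congr rfl fun u _ => ?_
          rw [Real.mul_rpow (by positivity) (norm_nonneg _), ENNReal.ofReal_mul (by positivity)]

theorem isSubsolution_greenMoment [Countable V] [IsProbabilityMeasure μ]
    (hK : IsBoundedHopping G K κ b) (hA : ∀ x, (A x).IsHermitian) (hB : ∀ x, (B x).IsHermitian)
    (hz : z.im ≠ 0) (hs : 0 < s) (hs1 : s ≤ 1) (hg : 0 < g) (ha : 0 ≤ a)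
    (hdec : ∀ x, SiteDecoupling μ (A x) (B x) s a z) (y : V) :
    IsSubsolution G y (ENNReal.ofReal a) (ENNReal.ofReal (a * (|b| / g) ^ s))
      fun x => greenMoment G K g A B μ s z x y := by
  classical
  intro x
  refine (hK.greenMoment_le_fracMoment_mul hA hB hz (hdec x) y).trans ?_
  rw [ENNReal.ofReal_mul ha, mul_assoc, ← mul_add]
  gcongr
  refine (lintegral_mono fun f => hK.ofReal_norm_mul_green_rpow_le
    (isHermitian_sitePotential hA hB f) hz hs hs1 hg x y).trans_eq ?_
  rw [lintegral_add_left measurable_const, lintegral_const, measure_univ, mul_one,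
    lintegral_const_mul' _ _ ENNReal.ofReal_ne_top,
    lintegral_finsetSum _ fun u _ => hK.measurable_green_rpow hA hB hz u y s]
  simp only [greenMoment, fracMoment]

lemma greenMoment_le_im_inv [IsProbabilityMeasure μ] (hK : IsBoundedHopping G K κ b)
    (hA : ∀ x, (A x).IsHermitian) (hB : ∀ x, (B x).IsHermitian) (hz : z.im ≠ 0) (hs : 0 ≤ s)
    (x y : V) : greenMoment G K g A B μ s z x y ≤ ENNReal.ofReal (|z.im|⁻¹ ^ s) := by
  refine (lintegral_mono fun f => ENNReal.ofReal_le_ofReal (Real.rpow_le_rpow (norm_nonneg _)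
    (hK.norm_green_le (isHermitian_sitePotential hA hB f) hz x y) hs)).trans_eq ?_
  rw [lintegral_const, measure_univ, mul_one]

theorem greenMoment_le_powDist [Countable V] [IsProbabilityMeasure μ]
    (hK : IsBoundedHopping G K κ b) (hA : ∀ x, (A x).IsHermitian) (hB : ∀ x, (B x).IsHermitian)
    (hz : z.im ≠ 0) (hs : 0 < s) (hs1 : s ≤ 1) (hg : 0 < g) (ha : 0 ≤ a)
    (hdec : ∀ x, SiteDecoupling μ (A x) (B x) s a z) (hκ : κ * (a * (|b| / g) ^ s) ≤ 1 / 2)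
    (x y : V) :
    greenMoment G K g A B μ s z x y ≤
      ENNReal.ofReal (2 * a * powDist G (κ * (a * (|b| / g) ^ s)) x y) := by
  have hρ : (κ : ℝ≥0∞) * ENNReal.ofReal (a * (|b| / g) ^ s) =
      ENNReal.ofReal (κ * (a * (|b| / g) ^ s)) := by
    rw [ENNReal.ofReal_mul (p := (κ : ℝ)) (by positivity), ENNReal.ofReal_natCast]
  refine ((hK.isSubsolution_greenMoment hA hB hz hs hs1 hg ha hdec y).le_pow_dist hK.degree_le
    (natCast_mul_ofReal_le_half hκ) ENNReal.ofReal_ne_top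
    (fun x => hK.greenMoment_le_im_inv hA hB hz hs.le x y) ENNReal.ofReal_ne_top x).trans_eq ?_
  rw [ENNReal.ofReal_mul (p := 2 * a) (by positivity), ENNReal.ofReal_mul (p := 2) (by norm_num),
    ENNReal.ofReal_ofNat, powDist, hρ]
  split_ifs
  · rw [ENNReal.ofReal_pow (by positivity)]
  · rw [ENNReal.ofReal_zero]

theorem tsum_greenMoment_le [Countable V] [IsProbabilityMeasure μ]
    (hK : IsBoundedHopping G K κ b) (hA : ∀ x, (A x).IsHermitian) (hB : ∀ x, (B x).IsHermitian)
    (hz : z.im ≠ 0) (hs : 0 < s) (hs1 : s ≤ 1) (hg : 0 < g) (ha : 0 ≤ a)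
    (hdec : ∀ x, SiteDecoupling μ (A x) (B x) s a z) (hκ : κ * (a * (|b| / g) ^ s) ≤ 1 / 2)
    (y : V) :
    ∑' x, greenMoment G K g A B μ s z x y ≤ ENNReal.ofReal (2 * a) := by
  rw [ENNReal.ofReal_mul zero_le_two, ENNReal.ofReal_ofNat]
  exact (hK.isSubsolution_greenMoment hA hB hz hs hs1 hg ha hdec y).tsum_le hK.degree_le
    (natCast_mul_ofReal_le_half hκ) ENNReal.ofReal_ne_top
    fun x => hK.greenMoment_le_im_inv hA hB hz hs.le x y

end IsBoundedHopping

end MomentBounds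

section BoundaryValues

lemma exists_dominating_of_antitoneOn {Ω : Type*} [MeasurableSpace Ω] {P : Measure Ω}
    {F : ℝ → Ω → ℝ≥0∞} {M : ℝ≥0∞} (hF : ∀ ε, 0 < ε → Measurable (F ε))
    (hanti : ∀ ω, AntitoneOn (fun ε => F ε ω) (Set.Ioi 0))
    (hM : ∀ ε, 0 < ε → ε ≤ 1 → ∫⁻ ω, F ε ω ∂P ≤ M) :
    ∃ D : Ω → ℝ≥0∞, Measurable D ∧ ∫⁻ ω, D ω ∂P ≤ M ∧ ∀ ω ε, 0 < ε → F ε ω ≤ D ω := by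
  have hpos (n : ℕ) : (0 : ℝ) < 1 / (n + 1) := by positivity
  have hle {m n : ℕ} (h : m ≤ n) : (1 : ℝ) / (n + 1) ≤ 1 / (m + 1) :=
    one_div_le_one_div_of_le (by positivity) (by gcongr)
  refine ⟨fun ω => ⨆ n : ℕ, F (1 / (n + 1)) ω, .iSup fun n => hF _ (hpos n), ?_, fun ω ε hε => ?_⟩
  · rw [lintegral_iSup (fun n => hF _ (hpos n)) fun m n h ω => hanti ω (hpos n) (hpos m) (hle h)]
    exact iSup_le fun n => hM _ (hpos n) (by simpa using hle n.zero_le)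
  · obtain ⟨n, hn⟩ := exists_nat_one_div_lt hε
    exact (hanti ω (hpos n) hε hn.le).trans (le_iSup (fun n : ℕ => F (1 / (n + 1)) ω) n)

variable {V : Type u} {k : ℕ} {G : SimpleGraph V} [G.LocallyFinite] {K : V → V → Mat k}
  {κ : ℕ} {b g s lam : ℝ} {A B : V → Mat k}

lemma norm_sq_le_rpow_mul_rpow (ψ : L2 V k) (hs : 0 < s) (hs2 : s ≤ 2) (x : V) :
    ‖ψ x‖ ^ 2 ≤ ‖ψ‖ ^ (2 - s) * ‖ψ x‖ ^ s := by
  have hx : ‖ψ x‖ ≤ ‖ψ‖ := lp.norm_apply_le_norm (by norm_num) ψ x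
  rcases (norm_nonneg (ψ x)).eq_or_lt with h | h
  · rw [← h, Real.zero_rpow hs.ne', mul_zero, zero_pow two_ne_zero]
  · calc ‖ψ x‖ ^ 2 = ‖ψ x‖ ^ (2 - s) * ‖ψ x‖ ^ s := by
          rw [← Real.rpow_add h, sub_add_cancel, Real.rpow_two]
      _ ≤ ‖ψ‖ ^ (2 - s) * ‖ψ x‖ ^ s := by gcongr

lemma ofReal_norm_rpow_le_tsum (ψ : L2 V k) (hs : 0 < s) (hs2 : s ≤ 2) :
    ENNReal.ofReal (‖ψ‖ ^ s) ≤ ∑' x, ENNReal.ofReal (‖ψ x‖ ^ s) := by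
  rcases (norm_nonneg ψ).eq_or_lt with h0 | h0
  · rw [← h0, Real.zero_rpow hs.ne', ENNReal.ofReal_zero]
    exact zero_le
  have hsq : HasSum (fun x => ‖ψ x‖ ^ 2) (‖ψ‖ ^ 2) := by
    simpa using lp.hasSum_norm (p := 2) (by norm_num) ψ
  have hpos : ENNReal.ofReal (‖ψ‖ ^ (2 - s)) ≠ 0 := by
    rw [Ne, ENNReal.ofReal_eq_zero, not_le]
    positivity
  refine (ENNReal.mul_le_mul_iff_right hpos ENNReal.ofReal_ne_top).1 ?_
  calc ENNReal.ofReal (‖ψ‖ ^ (2 - s)) * ENNReal.ofReal (‖ψ‖ ^ s)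
      = ENNReal.ofReal (‖ψ‖ ^ 2) := by
        rw [← ENNReal.ofReal_mul (by positivity), ← Real.rpow_add h0, sub_add_cancel,
          Real.rpow_two]
    _ = ∑' x, ENNReal.ofReal (‖ψ x‖ ^ 2) := by
        rw [← hsq.tsum_eq, ENNReal.ofReal_tsum_of_nonneg (fun x => by positivity) hsq.summable]
    _ ≤ ∑' x, ENNReal.ofReal (‖ψ‖ ^ (2 - s)) * ENNReal.ofReal (‖ψ x‖ ^ s) := by
        refine ENNReal.tsum_le_tsum fun x => ?_
        rw [← ENNReal.ofReal_mul (by positivity)]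
        exact ENNReal.ofReal_le_ofReal (norm_sq_le_rpow_mul_rpow ψ hs hs2 x)
    _ = ENNReal.ofReal (‖ψ‖ ^ (2 - s)) * ∑' x, ENNReal.ofReal (‖ψ x‖ ^ s) := ENNReal.tsum_mul_left

lemma le_toReal_rpow_inv_of_ofReal_rpow_le {t : ℝ} {D : ℝ≥0∞} (ht : 0 ≤ t) (hs : 0 < s)
    (hD : D ≠ ⊤) (h : ENNReal.ofReal (t ^ s) ≤ D) : t ≤ D.toReal ^ s⁻¹ := by
  rw [ENNReal.ofReal_le_iff_le_toReal hD] at h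
  exact (Real.le_rpow_inv_iff_of_pos ht ENNReal.toReal_nonneg hs).2 h

namespace IsBoundedHopping

open Classical in
lemma tendsto_green_greenBoundary (hK : IsBoundedHopping G K κ b) {W : V → Mat k}
    (hW : ∀ x, (W x).IsHermitian) {M : Fin k → ℝ} (y : V)
    (hM : ∀ j ε, 0 < ε → ‖boundaryFamily (hamiltonian G K g W) lam
      (lp.single 2 y (EuclideanSpace.single j (1 : ℂ))) ε‖ ≤ M j) (x : V) :
    Tendsto (fun ε : ℝ => green G K g W (lam + ε * Complex.I) x y) (𝓝[>] 0)
      (𝓝 (greenBoundary G K g W lam x y)) := by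
  choose ψ hψ using fun j =>
    exists_tendsto_boundaryFamily (hK.isSelfAdjoint_hamiltonian hW) lam _ (hM j)
  refine tendsto_nhds_limUnder ⟨Matrix.of fun i j => ψ j x i, ?_⟩
  exact tendsto_pi_nhds.2 fun i => tendsto_pi_nhds.2 fun j =>
    ((continuous_l2_apply x i).tendsto (ψ j)).comp (hψ j)

section RandomPotential

variable {Ω : Type w} [MeasurableSpace Ω] {P : Measure Ω} {f : Ω → V → ℝ}

-- The norm of `boundaryFamily` increases as `ε ↓ 0`, so its supremum over all `ε > 0` is a
-- monotone limit and inherits the moment bound.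
open Classical in
lemma exists_dominating_boundaryFamily [Countable V] (hK : IsBoundedHopping G K κ b)
    (hA : ∀ x, (A x).IsHermitian) (hB : ∀ x, (B x).IsHermitian) (hs : 0 < s) (hs2 : s ≤ 2)
    (hf : Measurable f) {M : ℝ≥0∞} (y : V)
    (hsum : ∀ ε : ℝ, 0 < ε → ε ≤ 1 → ∑' x, fracMoment P s (fun ω =>
      green G K g (sitePotential A B (f ω)) (lam + ε * Complex.I) x y) ≤ M) (j : Fin k) :
    ∃ D : Ω → ℝ≥0∞, Measurable D ∧ ∫⁻ ω, D ω ∂P ≤ M ∧ ∀ ω ε, 0 < ε →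
      ENNReal.ofReal (‖boundaryFamily (hamiltonian G K g (sitePotential A B (f ω))) lam
        (lp.single 2 y (EuclideanSpace.single j (1 : ℂ))) ε‖ ^ s) ≤ D ω := by
  have him {ε : ℝ} (hε : 0 < ε) : ((lam : ℂ) + ε * Complex.I).im ≠ 0 := by simpa using hε.ne'
  refine exists_dominating_of_antitoneOn (fun ε hε => ?_) (fun ω ε' hε' ε _ h => ?_)
    fun ε hε hε1 => ?_
  · exact (((hK.continuous_resolventOp (isHermitian_sitePotential hA hB) continuous_sitePotential
      (him hε) _).norm.measurable.comp hf).pow_const s).ennreal_ofReal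
  · dsimp only
    gcongr
    exact norm_boundaryFamily_anti
      (hK.isSelfAdjoint_hamiltonian (isHermitian_sitePotential hA hB _)) lam _ hε' h
  · refine le_trans ?_ (hsum ε hε hε1)
    have hmeas (x : V) : AEMeasurable (fun ω => ENNReal.ofReal
        (‖green G K g (sitePotential A B (f ω)) (lam + ε * Complex.I) x y‖ ^ s)) P :=
      ((hK.measurable_green_rpow hA hB (him hε) x y s).comp hf).aemeasurable
    simp only [fracMoment]
    rw [← lintegral_tsum hmeas]
    refine lintegral_mono fun ω => (ofReal_norm_rpow_le_tsum _ hs hs2).trans ?_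
    gcongr with x
    exact norm_apply_single_le _ x y j

theorem tendsto_green_fracMoment [Countable V] (hK : IsBoundedHopping G K κ b)
    (hA : ∀ x, (A x).IsHermitian) (hB : ∀ x, (B x).IsHermitian) (hs : 0 < s) (hs1 : s ≤ 1)
    (hf : Measurable f) {M : ℝ≥0∞} (hM : M ≠ ⊤) (y : V)
    (hsum : ∀ ε : ℝ, 0 < ε → ε ≤ 1 → ∑' x, fracMoment P s (fun ω =>
      green G K g (sitePotential A B (f ω)) (lam + ε * Complex.I) x y) ≤ M) (x : V) :
    (∀ᵐ ω ∂P, Tendsto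
      (fun ε : ℝ => green G K g (sitePotential A B (f ω)) (lam + ε * Complex.I) x y)
      (𝓝[>] 0) (𝓝 (greenBoundary G K g (sitePotential A B (f ω)) lam x y))) ∧
    Tendsto (fun ε : ℝ => fracMoment P s fun ω =>
        green G K g (sitePotential A B (f ω)) (lam + ε * Complex.I) x y)
      (𝓝[>] 0)
      (𝓝 (fracMoment P s fun ω => greenBoundary G K g (sitePotential A B (f ω)) lam x y)) := by
  classical
  choose D hDmeas hDint hD using hK.exists_dominating_boundaryFamily (g := g) (lam := lam)
    hA hB hs (hs1.trans one_le_two) hf y hsum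
  have hDtop (j : Fin k) : ∫⁻ ω, D j ω ∂P ≠ ⊤ := ne_top_of_le_ne_top hM (hDint j)
  have hlim : ∀ᵐ ω ∂P, Tendsto
      (fun ε : ℝ => green G K g (sitePotential A B (f ω)) (lam + ε * Complex.I) x y)
      (𝓝[>] 0) (𝓝 (greenBoundary G K g (sitePotential A B (f ω)) lam x y)) := by
    filter_upwards [ae_all_iff.2 fun j => ae_lt_top (hDmeas j) (hDtop j)] with ω hω
    exact hK.tendsto_green_greenBoundary (isHermitian_sitePotential hA hB _) y (fun j ε hε =>
      le_toReal_rpow_inv_of_ofReal_rpow_le (norm_nonneg _) hs (hω j).ne (hD j ω ε hε)) x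
  refine ⟨hlim, tendsto_lintegral_filter_of_dominated_convergence
    (fun ω => ∑ _ : Fin k, ∑ j : Fin k, D j ω) ?_ ?_ ?_ ?_⟩
  · filter_upwards [self_mem_nhdsWithin] with ε hε
    have him : ((lam : ℂ) + ε * Complex.I).im ≠ 0 := by simpa using (Set.mem_Ioi.1 hε).ne'
    exact (hK.measurable_green_rpow hA hB him x y s).comp hf
  · filter_upwards [self_mem_nhdsWithin] with ε hε
    refine ae_of_all _ fun ω => (ofReal_norm_rpow_le_sum_entries _ hs hs1).trans ?_
    refine Finset.sum_le_sum fun i _ => Finset.sum_le_sum fun j _ => le_trans ?_ (hD j ω ε hε)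
    gcongr
    exact norm_kernelAt_entry_le _ x y i j
  · rw [lintegral_finsetSum _ fun i _ => Finset.measurable_sum _ fun j _ => hDmeas j]
    refine ENNReal.sum_ne_top.2 fun i _ => ?_
    rw [lintegral_finsetSum _ fun j _ => hDmeas j]
    exact ENNReal.sum_ne_top.2 fun j _ => hDtop j
  · filter_upwards [hlim] with ω hω
    exact ENNReal.tendsto_ofReal (hω.norm.rpow_const (Or.inr hs.le))

end RandomPotential

end IsBoundedHopping

end BoundaryValues

section GreenDecay

variable {V : Type u} {k : ℕ} {G : SimpleGraph V} [G.LocallyFinite] {K : V → V → Mat k}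
  {κ : ℕ} {a b g s lam : ℝ} {A B : V → Mat k} {μ : Measure ℝ}
  {Ω : Type w} [MeasurableSpace Ω] {P : Measure Ω} {f : Ω → V → ℝ} [Countable V]

namespace IsBoundedHopping

lemma fracMoment_green_eq_greenMoment (hK : IsBoundedHopping G K κ b)
    (hA : ∀ x, (A x).IsHermitian) (hB : ∀ x, (B x).IsHermitian) {z : ℂ} (hz : z.im ≠ 0)
    (hf : Measurable f) (hlaw : P.map f = Measure.infinitePi fun _ => μ) (x y : V) :
    (fracMoment P s fun ω => green G K g (sitePotential A B (f ω)) z x y) =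
      greenMoment G K g A B μ s z x y := by
  rw [greenMoment, ← hlaw, fracMoment, fracMoment,
    lintegral_map (hK.measurable_green_rpow hA hB hz x y s) hf]

theorem tendsto_green_of_siteDecoupling [IsProbabilityMeasure μ] (hK : IsBoundedHopping G K κ b)
    (hA : ∀ x, (A x).IsHermitian) (hB : ∀ x, (B x).IsHermitian) (hs : 0 < s) (hs1 : s ≤ 1)
    (hg : 0 < g) (ha : 0 ≤ a)
    (hdec : ∀ ε : ℝ, 0 < ε → ε ≤ 1 → ∀ x, SiteDecoupling μ (A x) (B x) s a (lam + ε * Complex.I))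
    (hκ : κ * (a * (|b| / g) ^ s) ≤ 1 / 2) (hf : Measurable f)
    (hlaw : P.map f = Measure.infinitePi fun _ => μ) (x y : V) :
    (∀ᵐ ω ∂P, Tendsto
      (fun ε : ℝ => green G K g (sitePotential A B (f ω)) (lam + ε * Complex.I) x y)
      (𝓝[>] 0) (𝓝 (greenBoundary G K g (sitePotential A B (f ω)) lam x y))) ∧
    Tendsto (fun ε : ℝ => fracMoment P s fun ω =>
        green G K g (sitePotential A B (f ω)) (lam + ε * Complex.I) x y)
      (𝓝[>] 0)
      (𝓝 (fracMoment P s fun ω => greenBoundary G K g (sitePotential A B (f ω)) lam x y)) := by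
  refine hK.tendsto_green_fracMoment hA hB hs hs1 hf (M := ENNReal.ofReal (2 * a))
    ENNReal.ofReal_ne_top y (fun ε hε hε1 => ?_) x
  have him : ((lam : ℂ) + ε * Complex.I).im ≠ 0 := by simpa using hε.ne'
  simp only [hK.fracMoment_green_eq_greenMoment hA hB him hf hlaw]
  exact hK.tsum_greenMoment_le hA hB him hs hs1 hg ha (hdec ε hε hε1) hκ y

theorem fracMoment_greenBoundary_le [IsProbabilityMeasure μ] (hK : IsBoundedHopping G K κ b)
    (hA : ∀ x, (A x).IsHermitian) (hB : ∀ x, (B x).IsHermitian) (hs : 0 < s) (hs1 : s ≤ 1)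
    (hg : 0 < g) (ha : 0 ≤ a)
    (hdec : ∀ ε : ℝ, 0 < ε → ε ≤ 1 → ∀ x, SiteDecoupling μ (A x) (B x) s a (lam + ε * Complex.I))
    (hκ : κ * (a * (|b| / g) ^ s) ≤ 1 / 2) (hf : Measurable f)
    (hlaw : P.map f = Measure.infinitePi fun _ => μ) (x y : V) :
    fracMoment P s (fun ω => greenBoundary G K g (sitePotential A B (f ω)) lam x y) ≤
      ENNReal.ofReal (2 * a * powDist G (κ * (a * (|b| / g) ^ s)) x y) := by
  refine le_of_tendsto
    (hK.tendsto_green_of_siteDecoupling hA hB hs hs1 hg ha hdec hκ hf hlaw x y).2 ?_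
  filter_upwards [Ioc_mem_nhdsGT one_pos] with ε hε
  have him : ((lam : ℂ) + ε * Complex.I).im ≠ 0 := by simpa using hε.1.ne'
  rw [hK.fracMoment_green_eq_greenMoment hA hB him hf hlaw]
  exact hK.greenMoment_le_powDist hA hB him hs hs1 hg ha (hdec ε hε.1 hε.2) hκ x y

end IsBoundedHopping

end GreenDecay

section Constants

lemma powDist_le_powDist {V : Type u} (G : SimpleGraph V) {r r' : ℝ} (hr : 0 ≤ r) (h : r ≤ r')
    (x y : V) : powDist G r x y ≤ powDist G r' x y := by
  unfold powDist
  split_ifs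
  · gcongr
  · exact le_rfl

lemma powDist_nonneg {V : Type u} (G : SimpleGraph V) {r : ℝ} (hr : 0 ≤ r) (x y : V) :
    0 ≤ powDist G r x y := by
  unfold powDist
  split_ifs
  · exact pow_nonneg hr _
  · exact le_rfl

lemma le_of_le_mul_div {α q s : ℝ} {k : ℕ} (hα : 0 < α) (hq : 0 < q) (hk : 1 ≤ k)
    (h : s ≤ α * q / (2 * k * α + k * q)) : s ≤ α := by
  have hk' : (1 : ℝ) ≤ k := by exact_mod_cast hk
  refine h.trans ((div_le_iff₀ (by positivity)).2 ?_)
  gcongr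
  nlinarith

variable {s c b g l C : ℝ} {κ : ℕ}

lemma natCast_mul_div_mul_rpow_le_half (hs : 0 < s) (hc : 0 ≤ c) (hg : 0 < g) (hl : 0 < l)
    (hC : (2 * c * |b| ^ s) ^ (1 / s) ≤ C) (hCg : C * (κ : ℝ) ^ (1 / s) / l ≤ g) :
    κ * (c / l ^ s * (|b| / g) ^ s) ≤ 1 / 2 := by
  have hroot : (2 * c * |b| ^ s * κ) ^ s⁻¹ ≤ g * l := by
    rw [← one_div, Real.mul_rpow (by positivity) (by positivity)]
    exact (mul_le_mul_of_nonneg_right hC (by positivity)).trans ((div_le_iff₀ hl).1 hCg)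
  have hpow : 2 * c * |b| ^ s * κ ≤ g ^ s * l ^ s := by
    rw [← Real.mul_rpow hg.le hl.le]
    exact (Real.rpow_inv_le_iff_of_pos (by positivity) (by positivity) hs).1 hroot
  rw [Real.div_rpow (abs_nonneg b) hg.le, div_mul_div_comm, mul_div_assoc',
    div_le_div_iff₀ (by positivity) (by norm_num)]
  linarith

lemma two_mul_div_mul_powDist_le {V : Type u} (G : SimpleGraph V) (hc : 0 ≤ c) (hg : 0 < g)
    (hl : 0 < l) (hC : 2 * c ≤ C) (hbC : c * |b| ^ s ≤ C) (x y : V) :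
    2 * (c / l ^ s) * powDist G (κ * (c / l ^ s * (|b| / g) ^ s)) x y ≤
      C / l ^ s * powDist G (C * κ / (g ^ s * l ^ s)) x y := by
  have hbase : κ * (c / l ^ s * (|b| / g) ^ s) ≤ C * κ / (g ^ s * l ^ s) :=
    calc κ * (c / l ^ s * (|b| / g) ^ s) = c * |b| ^ s * κ / (g ^ s * l ^ s) := by
          rw [Real.div_rpow (abs_nonneg b) hg.le]
          ring
      _ ≤ C * κ / (g ^ s * l ^ s) := by gcongr
  have hbase_nonneg : 0 ≤ κ * (c / l ^ s * (|b| / g) ^ s) := by positivity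
  rw [mul_div_assoc']
  have hC0 : 0 ≤ C := by linarith
  gcongr ?_ / _ * ?_
  · exact powDist_nonneg G hbase_nonneg x y
  · exact powDist_le_powDist G hbase_nonneg hbase x y

end Constants

theorem theorem1 (α q s CA1 CA2 CB1 CB2 CB3 : ℝ) (hα : 0 < α) (hq : 0 < q) (hs : 0 < s) :
    ∃ C : ℝ, 0 < C ∧
      ∀ (V : Type u) [Countable V] (G : SimpleGraph V) [G.LocallyFinite]
        (κ : ℕ) (_ : ∀ x, G.degree x ≤ κ)
        (k : ℕ) (_ : 1 ≤ k) (_ : s ≤ α * q / (2 * k * α + k * q))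
        (Ω : Type w) [MeasurableSpace Ω] (P : Measure Ω) [IsProbabilityMeasure P]
        (v : V → Ω → ℝ) (_ : ∀ x, Measurable (v x)) (_ : iIndepFun v P)
        (μ : Measure ℝ) [IsProbabilityMeasure μ] (_ : ∀ x, P.map (v x) = μ)
        (_ : IsAlphaRegular μ α CA1) (_ : HasMomentBound μ q CA2)
        (A B : V → Mat k) (_ : ∀ x, (A x).IsHermitian) (_ : ∀ x, (B x).IsHermitian)
        (_ : ∀ x, IsUnit (A x) ∧ ‖A x‖ ≤ CB1 ∧ ‖(A x)⁻¹‖ ≤ CB1)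
        (_ : ∀ x, ‖B x‖ ≤ CB2)
        (K : V → V → Mat k) (_ : ∀ x y, G.Adj x y → K y x = (K x y)ᴴ ∧ ‖K x y‖ ≤ CB3)
        (g : ℝ) (_ : 0 < g),
        -- the resolvent exists at every non-real energy
        (∀ ω (z : ℂ), z.im ≠ 0 → ∃ R,
          IsResolventAt (hamiltonian G K g (sitePotential A B fun x => v x ω)) z R) ∧
        ∀ lam : ℝ, C * (κ : ℝ) ^ (1 / s) / (1 + |lam|) ≤ g → ∀ x y : V,
          -- `G_{λ+i0}(x,y)` exists almost surely
          (∀ᵐ ω ∂P, Tendsto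
            (fun ε : ℝ => green G K g (sitePotential A B fun x => v x ω)
              ((lam : ℂ) + (ε : ℂ) * Complex.I) x y)
            (𝓝[>] 0)
            (𝓝 (greenBoundary G K g (sitePotential A B fun x => v x ω) lam x y))) ∧
          -- its fractional moment is the limit of those of `G_{λ+iε}(x,y)`
          Tendsto
            (fun ε : ℝ => fracMoment P s fun ω =>
              green G K g (sitePotential A B fun x => v x ω)
                ((lam : ℂ) + (ε : ℂ) * Complex.I) x y)
            (𝓝[>] 0)
            (𝓝 (fracMoment P s fun ω =>
              greenBoundary G K g (sitePotential A B fun x => v x ω) lam x y)) ∧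
          fracMoment P s (fun ω =>
              greenBoundary G K g (sitePotential A B fun x => v x ω) lam x y)
            ≤ ENNReal.ofReal (C / (1 + |lam|) ^ s *
                powDist G (C * κ / (g ^ s * (1 + |lam|) ^ s)) x y) := by
  obtain ⟨c, hc, hdec⟩ := exists_siteDecoupling CA1 CA2 CB1 CB2 hα hq hs
  have hcb : 0 ≤ c * |CB3| ^ s := by positivity
  have hroot : 0 ≤ (2 * c * |CB3| ^ s) ^ (1 / s) := by positivity
  refine ⟨2 * c + c * |CB3| ^ s + (2 * c * |CB3| ^ s) ^ (1 / s), by positivity, ?_⟩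
  intro V _ G _ κ hdeg k hk hsk Ω _ P _ v hv hind μ _ hvμ hreg hmom A B hA hB hAb hBb K hKb g hg
  have hK : IsBoundedHopping G K κ CB3 :=
    ⟨hdeg, fun x y h => (hKb x y h).1, fun x y h => (hKb x y h).2⟩
  have hs1 : s ≤ 1 := (le_of_le_mul_div hα hq hk hsk).trans hreg.exponent_le_one
  have hlaw : P.map (fun ω x => v x ω) = Measure.infinitePi fun _ : V => μ := by
    simpa only [hvμ] using (iIndepFun_iff_map_fun_eq_infinitePi_map hv).1 hind
  refine ⟨fun ω z hz => exists_isResolventAt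
    (hK.isSelfAdjoint_hamiltonian (isHermitian_sitePotential hA hB _)) hz, fun lam hlam x y => ?_⟩
  have hl : 0 < 1 + |lam| := by positivity
  have hdec_site (ε : ℝ) (hε : 0 < ε) (hε1 : ε ≤ 1) (x : V) :
      SiteDecoupling μ (A x) (B x) s (c / (1 + |lam|) ^ s) (lam + ε * Complex.I) :=
    hdec k hk hsk μ inferInstance hreg hmom (A x) (B x) (hAb x).1 (hAb x).2.1 (hAb x).2.2
      (hBb x) lam ε hε hε1
  have hsmall : κ * (c / (1 + |lam|) ^ s * (|CB3| / g) ^ s) ≤ 1 / 2 :=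
    natCast_mul_div_mul_rpow_le_half hs hc.le hg hl (by linarith) hlam
  obtain ⟨hlim, hmlim⟩ := hK.tendsto_green_of_siteDecoupling hA hB hs hs1 hg (by positivity)
    hdec_site hsmall (measurable_pi_iff.2 hv) hlaw x y
  refine ⟨hlim, hmlim, (hK.fracMoment_greenBoundary_le hA hB hs hs1 hg (by positivity) hdec_site
    hsmall (measurable_pi_iff.2 hv) hlaw x y).trans (ENNReal.ofReal_le_ofReal ?_)⟩
  exact two_mul_div_mul_powDist_le G hc.le hg hl (by linarith) (by linarith) x y
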